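/- Let ${\cal A}$ be a von Neumann algebra (acting on a complex Hilbert space) with a finite, normal, faithful (positive) trace $\tau:{\cal A}\to\mathbb C$. Let ${\cal A}_h$ be the real Banach space of selfadjoint elements of ${\cal A}$ with the operator norm, and let $\Sigma\subset{\cal A}_h$ be the set of positive invertible elements, with tangent spaces $T_a\Sigma={\cal A}_h$ and the metric $\langle x,y\rangle_a=\tau(xa^{-1}ya^{-1})$. A geodesic of $\Sigma$ is a norm-smooth curve $\gamma:\mathbb R\to\Sigma$ with $\ddot\gamma=\dot\gamma\gamma^{-1}\dot\gamma$ (constant curves are allowed); the exponential map is $\mathrm{Exp}_p(v)=p^{1/2}e^{p^{-1/2}vp^{-1/2}}p^{1/2}$. Let $H\subset{\cal A}_h$ be a norm-closed real linear subspace such that $M=e^H=\{e^x:x\in H\}$ is geodesically convex, i.e. if $\gamma$ is a geodesic of $\Sigma$ with $\gamma(0),\gamma(1)\in M$, then $\gamma(t)\in M$ for all $t\in[0,1]$. For $p\in M$ put $T_pM=p^{1/2}Hp^{1/2}$, and let $NM$ be the normal bundle of $M$, the set of pairs $(p,v)$ with $p\in M$, $v\in{\cal A}_h$ and $\langle v,w\rangle_p=0$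 for all $w\in T_pM$. A geodesic $\gamma$ is orthogonal to $M$ if there is $t_0\in\mathbb R$ with $\gamma(t_0)\in M$ and $\langle\dot\gamma(t_0),w\rangle_{\gamma(t_0)}=0$ for all $w\in T_{\gamma(t_0)}M$. Suppose that $H$ has a closed $\tau$-orthogonal supplement in ${\cal A}_h$: a norm-closed real subspace $S\subset{\cal A}_h$ with ${\cal A}_h=H\oplus S$ and $\tau(xy)=0$ for all $x\in H$, $y\in S$. Then for every $r\in\Sigma$ there is a geodesic of $\Sigma$ that passes through $r$ and is orthogonal to $M$. Moreover, the normal exponential map $E:NM\to\Sigma$, $E(p,v)=\mathrm{Exp}_p(v)$, is onto: $E(NM)=\Sigma$. -/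

import Mathlib

open scoped ComplexOrder ContDiff

/-! ### A von Neumann algebra as an ordered C⋆-algebra

The order on `↥N` is the one induced by the Loewner order of bounded operators. -/

instance VonNeumannAlgebra.instSMulMemClass {K : Type*} [NormedAddCommGroup K]
    [InnerProductSpace ℂ K] [CompleteSpace K] :
    SMulMemClass (VonNeumannAlgebra K) ℂ (K →L[ℂ] K) where
  smul_mem {s} c _ hx := s.toStarSubalgebra.smul_mem hx c

instance VonNeumannAlgebra.instIsClosed {K : Type*} [NormedAddCommGroup K]
    [InnerProductSpace ℂ K] [CompleteSpace K] (N : VonNeumannAlgebra K) :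
    IsClosed (N : Set (K →L[ℂ] K)) := by
  rw [← N.centralizer_centralizer]
  exact Set.isClosed_centralizer _

noncomputable instance VonNeumannAlgebra.instCStarAlgebra {K : Type*} [NormedAddCommGroup K]
    [InnerProductSpace ℂ K] [CompleteSpace K] (N : VonNeumannAlgebra K) : CStarAlgebra N :=
  StarSubalgebra.cstarAlgebra N

instance VonNeumannAlgebra.instStarOrderedRing {K : Type*} [NormedAddCommGroup K]
    [InnerProductSpace ℂ K] [CompleteSpace K] (N : VonNeumannAlgebra K) : StarOrderedRing N := by
  refine StarOrderedRing.of_nonneg_iff' ?_ ?_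
  · intro x y hxy z
    exact add_le_add_right (α := K →L[ℂ] K) hxy z
  · intro x
    constructor
    · intro hx
      have hx' : (0 : K →L[ℂ] K) ≤ (x : K →L[ℂ] K) := hx
      have hs : CFC.sqrt (x : K →L[ℂ] K) ∈ N := by
        rw [CFC.sqrt_eq_real_sqrt _ hx', cfcₙ_eq_cfc]
        exact cfc_mem (𝕜' := ℂ) Real.sqrt x.2
      refine ⟨⟨_, hs⟩, Subtype.ext ?_⟩
      have h1 : star (CFC.sqrt (x : K →L[ℂ] K)) = CFC.sqrt (x : K →L[ℂ] K) :=
        (CFC.sqrt_nonneg (x : K →L[ℂ] K)).isSelfAdjoint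
      change (x : K →L[ℂ] K) = star (CFC.sqrt (x : K →L[ℂ] K)) * CFC.sqrt (x : K →L[ℂ] K)
      rw [h1, CFC.sqrt_mul_sqrt_self _ hx']
    · rintro ⟨s, rfl⟩
      exact star_mul_self_nonneg (s : K →L[ℂ] K)

namespace PosGeom

/-! ### The trace and the manifold of positive invertible elements -/

/-- `τ` is a finite, positive, faithful, normal trace. Normality: `τ` preserves suprema of bounded
increasing nets (directed sets) of positive elements. No normalization `τ 1 = 1` is imposed. -/
structure IsFaithfulNormalTrace {A : Type*} [CStarAlgebra A] [PartialOrder A] [StarOrderedRing A]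
    (τ : A →ₗ[ℂ] ℂ) : Prop where
  nonneg : ∀ x : A, 0 ≤ τ (star x * x)
  tracial : ∀ x y : A, τ (x * y) = τ (y * x)
  faithful : ∀ x : A, τ (star x * x) = 0 → x = 0
  normal : ∀ (D : Set A) (a : A), D.Nonempty → (∀ d ∈ D, 0 ≤ d) → DirectedOn (· ≤ ·) D →
    IsLUB D a → IsLUB ((fun d => (τ d).re) '' D) (τ a).re

/-- `Σ`, the set of positive invertible elements. -/
def posInv (A : Type*) [CStarAlgebra A] [PartialOrder A] : Set A :=
  {a | IsUnit a ∧ 0 ≤ a}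

/-- The Riemannian metric `⟨x, y⟩_a = τ(x a⁻¹ y a⁻¹)` at `a ∈ Σ`. -/
noncomputable def metricAt {A : Type*} [CStarAlgebra A] (τ : A →ₗ[ℂ] ℂ) (a x y : A) : ℂ :=
  τ (x * Ring.inverse a * y * Ring.inverse a)

/-- A (complete) geodesic of `Σ`: a norm-smooth curve `γ : ℝ → Σ` satisfying Euler's equation
`γ'' = γ' γ⁻¹ γ'`. Constant curves are allowed. -/
structure IsGeodesic {A : Type*} [CStarAlgebra A] [PartialOrder A] (γ : ℝ → A) : Prop where
  mem : ∀ t, γ t ∈ posInv A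
  smooth : ContDiff ℝ ∞ γ
  euler : ∀ t, deriv (deriv γ) t = deriv γ t * Ring.inverse (γ t) * deriv γ t

/-- `M ⊆ Σ` is convex: the geodesic joining two points of `M` stays in `M`. -/
def IsGeodConvex {A : Type*} [CStarAlgebra A] [PartialOrder A] (M : Set A) : Prop :=
  M ⊆ posInv A ∧
    ∀ γ : ℝ → A, IsGeodesic γ → γ 0 ∈ M → γ 1 ∈ M → ∀ t ∈ Set.Icc (0 : ℝ) 1, γ t ∈ M

/-- The exponential map `Exp_p(v) = p^{1/2} exp(p^{-1/2} v p^{-1/2}) p^{1/2}` of `Σ`. -/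
noncomputable def expMap {A : Type*} [CStarAlgebra A] [PartialOrder A] [StarOrderedRing A]
    (p v : A) : A :=
  p ^ (1 / 2 : ℝ) * NormedSpace.exp (p ^ (-(1 / 2) : ℝ) * v * p ^ (-(1 / 2) : ℝ)) *
    p ^ (1 / 2 : ℝ)

/-! ### Exponential sets and their normal bundles -/

/-- `M = e^H` for a real subspace `H` of the selfadjoint part `A_h`. -/
noncomputable def expSet {A : Type*} [CStarAlgebra A] (H : Submodule ℝ (selfAdjoint A)) : Set A :=
  (fun x : selfAdjoint A => NormedSpace.exp (x : A)) '' (H : Set (selfAdjoint A))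

/-- `T_p M = p^{1/2} H p^{1/2}`, the tangent space of `M = e^H` at `p ∈ M`. -/
noncomputable def tangentAt {A : Type*} [CStarAlgebra A] [PartialOrder A] [StarOrderedRing A]
    (H : Submodule ℝ (selfAdjoint A)) (p : A) : Set A :=
  (fun x : selfAdjoint A => p ^ (1 / 2 : ℝ) * (x : A) * p ^ (1 / 2 : ℝ)) ''
    (H : Set (selfAdjoint A))

/-- `v` is orthogonal to `M = e^H` at `p`. -/
def IsNormalAt {A : Type*} [CStarAlgebra A] [PartialOrder A] [StarOrderedRing A]
    (τ : A →ₗ[ℂ] ℂ) (H : Submodule ℝ (selfAdjoint A)) (p v : A) : Prop :=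
  ∀ w ∈ tangentAt H p, metricAt τ p v w = 0

/-- The normal bundle `NM` of `M = e^H`: pairs `(p, v)` with `p ∈ M` and `v ∈ T_p Σ = A_h`
orthogonal to `T_p M`. -/
def normalBundle {A : Type*} [CStarAlgebra A] [PartialOrder A] [StarOrderedRing A]
    (τ : A →ₗ[ℂ] ℂ) (H : Submodule ℝ (selfAdjoint A)) : Set (A × A) :=
  {z | z.1 ∈ expSet H ∧ IsSelfAdjoint z.2 ∧ IsNormalAt τ H z.1 z.2}

/-- The curve `γ` meets `M = e^H` at some point and is orthogonal to `M` there. -/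
def IsOrthogonalTo {A : Type*} [CStarAlgebra A] [PartialOrder A] [StarOrderedRing A]
    (τ : A →ₗ[ℂ] ℂ) (H : Submodule ℝ (selfAdjoint A)) (γ : ℝ → A) : Prop :=
  ∃ t : ℝ, γ t ∈ expSet H ∧ IsNormalAt τ H (γ t) (deriv γ t)

/-- `S` is a closed `τ`-orthogonal supplement of `H` in `A_h`. -/
structure IsOrthogonalSupplement {A : Type*} [CStarAlgebra A] (τ : A →ₗ[ℂ] ℂ)
    (H S : Submodule ℝ (selfAdjoint A)) : Prop where
  closed : IsClosed (S : Set (selfAdjoint A))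
  isCompl : IsCompl H S
  orthogonal : ∀ x ∈ H, ∀ y ∈ S, τ ((x : A) * (y : A)) = 0

end PosGeom

/-! Everything reduces to a factorization (`exists_factorization`): each `r ∈ Σ` is `e^h e^s e^h`
with `h ∈ H` and `s ∈ S`. The congruence by `e^h` is an isometry of Σ taking `1` to `e^{2h}`, so `t
↦ e^h e^{ts} e^h` is a geodesic through `r` that leaves `M` at `e^{2h}` in a normal direction.

Write `r = e^ρ`. The L²-norm of `relLog ρ h = log(e^{-h} e^ρ e^{-h})` plays the role of the distance
from `e^{2h}` to `r`, and `h` is found by minimizing it. The obstacle is that the geometry controls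
only the L²-norm, while `H` and Σ live in the operator norm. The minimum is therefore taken over the
ball `‖h‖ ≤ R` of `H`, and the constraint is shown to be harmless.

Existence: the exponential metric increasing property (`l2norm_sub_le_of_exp_eq`) gives a
semi-parallelogram law, and the ball is stable under geodesic midpoints (`norm_midpoint_le`), so a
minimizing sequence is L²-Cauchy. Norm-bounded sets are L²-complete (`exists_l2_limit`, a
noncommutative Egorov argument), and `H` is the orthogonal of `S`, so the limit stays in `H`.

Criticality: let `s = relLog ρ h` at a minimizer. Then `‖s + 2h‖ ≤ ‖ρ‖`, so the `H`-component `a` of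
`s + 2h` is bounded independently of `h` by means of the bounded projection onto `H` along `S`. If
`‖a‖ ≤ 2R - 1`, moving from `e^{2h}` in the direction `x = a - 2h` does not leave the ball. As `x`
is the `H`-component of `s`, minimality gives `τ(x²) = τ(sx) ≤ 0`, so `x = 0` and `s ∈ S`. The
competitors `e^h e^{εx} e^h` lie in `M` by analytic continuation along a geodesic
(`exp_sandwich_mem_expSet`). -/

namespace PosGeom

open NormedSpace

/-! ### Exponentials, spectral inequalities and order in a C⋆-algebra -/

section CStar

variable {A : Type*} [CStarAlgebra A]

theorem exp_add_of_comm {x y : A} (h : Commute x y) : exp (x + y) = exp x * exp y :=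
  letI : NormedAlgebra ℚ A := NormedAlgebra.restrictScalars ℚ ℝ A
  exp_add_of_commute h

theorem exp_mul_exp_neg (x : A) : exp x * exp (-x) = 1 := by
  rw [← exp_add_of_comm (Commute.neg_right rfl), add_neg_cancel, exp_zero]

theorem exp_neg_mul_exp (x : A) : exp (-x) * exp x = 1 := by
  rw [← exp_add_of_comm (Commute.neg_left rfl), neg_add_cancel, exp_zero]

theorem isUnit_exp' (x : A) : IsUnit (exp x) :=
  letI : NormedAlgebra ℚ A := NormedAlgebra.restrictScalars ℚ ℝ A
  isUnit_exp x

theorem exp_smul_mul_exp_smul (a b : ℝ) (x : A) :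
    exp (a • x) * exp (b • x) = exp ((a + b) • x) := by
  rw [add_smul, exp_add_of_comm]
  exact (Commute.refl x).smul_left a |>.smul_right b

theorem exp_mul_exp_self (x : A) : exp x * exp x = exp ((2 : ℝ) • x) := by
  rw [two_smul, exp_add_of_comm (Commute.refl x)]

theorem exp_half_mul_exp_half (x : A) : exp ((1 / 2 : ℝ) • x) * exp ((1 / 2 : ℝ) • x) = exp x := by
  rw [exp_smul_mul_exp_smul]; norm_num

theorem inverse_exp (x : A) : Ring.inverse (exp x) = exp (-x) := by
  have h := Ring.inverse_unit (M₀ := A) ⟨exp x, exp (-x), exp_mul_exp_neg x, exp_neg_mul_exp x⟩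
  exact h

theorem exp_conj {u v : A} (huv : u * v = 1) (hvu : v * u = 1) (x : A) :
    exp (u * x * v) = u * exp x * v :=
  letI : NormedAlgebra ℚ A := NormedAlgebra.restrictScalars ℚ ℝ A
  exp_units_conj ⟨u, v, huv, hvu⟩ x

theorem _root_.IsSelfAdjoint.real_smul {x : A} (hx : IsSelfAdjoint x) (c : ℝ) :
    IsSelfAdjoint (c • x) :=
  (IsSelfAdjoint.all c).smul hx

theorem exp_injective {x y : A} (hx : IsSelfAdjoint x) (hy : IsSelfAdjoint y)
    (h : exp x = exp y) : x = y := by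
  rw [← CFC.log_exp x, ← CFC.log_exp y, h]

theorem abs_le_norm_of_mem_spectrum {w : A} {t : ℝ} (ht : t ∈ spectrum ℝ w) : |t| ≤ ‖w‖ := by
  have := spectrum.norm_le_norm_mul_of_mem ht
  rcases subsingleton_or_nontrivial A with h | h
  · simp [spectrum.of_subsingleton] at ht
  · simpa using this

variable [PartialOrder A] [StarOrderedRing A]

omit [StarOrderedRing A] in
theorem mem_posInv_iff {a : A} : a ∈ posInv A ↔ IsStrictlyPositive a :=
  and_comm

theorem isStrictlyPositive_exp {x : A} (hx : IsSelfAdjoint x) : IsStrictlyPositive (exp x) :=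
  ⟨hx.exp_nonneg, isUnit_exp' x⟩

theorem isStrictlyPositive_conj {g c : A} (hg : IsUnit g) (hc : IsStrictlyPositive c) :
    IsStrictlyPositive (g * c * star g) :=
  ⟨star_right_conjugate_nonneg hc.1 g, (hg.mul hc.2).mul hg.star⟩

theorem isStrictlyPositive_exp_conj {x c : A} (hx : IsSelfAdjoint x) (hc : IsStrictlyPositive c) :
    IsStrictlyPositive (exp x * c * exp x) := by
  simpa [hx.exp.star_eq] using isStrictlyPositive_conj (isUnit_exp' x) hc

theorem one_add_le_exp {w : A} (hw : IsSelfAdjoint w) : 1 + w ≤ exp w := by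
  rw [← CFC.real_exp_eq_normedSpace_exp (a := w) hw]
  have h1 : (1 : A) + w = cfc (fun t : ℝ => 1 + t) w := by
    rw [cfc_const_add (R := ℝ) (1 : ℝ) (fun t => t) w, cfc_id' ℝ w, map_one]
  rw [h1]
  exact cfc_mono fun t _ => by linarith [Real.add_one_le_exp t]

theorem exp_le_one_add_add_sq {w : A} (hw : IsSelfAdjoint w) (h1 : ‖w‖ ≤ 1) :
    exp w ≤ 1 + w + algebraMap ℝ A (‖w‖ ^ 2) := by
  rw [← CFC.real_exp_eq_normedSpace_exp (a := w) hw]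
  have h2 : (1 : A) + w + algebraMap ℝ A (‖w‖ ^ 2) = cfc (fun t : ℝ => 1 + t + ‖w‖ ^ 2) w := by
    rw [cfc_add_const (R := ℝ) (‖w‖ ^ 2) (fun t => 1 + t) w,
      cfc_const_add (R := ℝ) (1 : ℝ) (fun t => t) w, cfc_id' ℝ w, map_one]
  rw [h2]
  refine cfc_mono fun t ht => ?_
  have h3 := abs_le_norm_of_mem_spectrum ht
  have h4 := Real.abs_exp_sub_one_sub_id_le (h3.trans h1)
  have h5 : t ^ 2 ≤ ‖w‖ ^ 2 := by
    rw [← sq_abs t]; gcongr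
  linarith [(abs_le.1 h4).2]

/-- A quadratic upper bound for `e^w + e^{-w} - 2`. -/
theorem exp_add_exp_neg_sub_two_le {w : A} (hw : IsSelfAdjoint w) (h1 : ‖w‖ ≤ 1) :
    exp w + exp (-w) - 2 ≤ (1 + ‖w‖ ^ 2) • (w * w) := by
  have e1 : exp (-w) = cfc (fun t : ℝ => Real.exp (-t)) w := by
    rw [← CFC.real_exp_eq_normedSpace_exp (a := -w) hw.neg, ← cfc_comp_neg (R := ℝ) Real.exp w]
  have e2 : (1 + ‖w‖ ^ 2) • (w * w) = cfc (fun t : ℝ => (1 + ‖w‖ ^ 2) * (t * t)) w := by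
    rw [cfc_const_mul (R := ℝ) _ (fun t => t * t) w, cfc_mul (R := ℝ) (fun t => t) (fun t => t) w,
      cfc_id' ℝ w]
  have e3 : exp w + exp (-w) - 2 = cfc (fun t : ℝ => Real.exp t + Real.exp (-t) + (-2)) w := by
    rw [cfc_add_const (R := ℝ) (-2) (fun t => Real.exp t + Real.exp (-t)) w,
      cfc_add (R := ℝ) (a := w) Real.exp (fun t => Real.exp (-t)), e1,
      CFC.real_exp_eq_normedSpace_exp (a := w) hw]
    simp [sub_eq_add_neg, map_ofNat]
  rw [e2, e3]
  refine cfc_mono fun t ht => ?_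
  have h3 := abs_le_norm_of_mem_spectrum ht
  have h5 : t ^ 2 ≤ ‖w‖ ^ 2 := by
    rw [← sq_abs t]; gcongr
  have h6 := Real.cosh_le_exp_half_sq t
  have h7 : t ^ 2 ≤ 1 := by
    rw [← sq_abs t]; exact pow_le_one₀ (abs_nonneg t) (h3.trans h1)
  have h8 : |t ^ 2 / 2| ≤ 1 := by
    rw [abs_of_nonneg (by positivity)]; linarith
  have h9 := (abs_le.1 (Real.abs_exp_sub_one_sub_id_le h8)).2
  rw [Real.cosh_eq] at h6
  nlinarith [sq_nonneg t, mul_le_mul_of_nonneg_left h5 (sq_nonneg t)]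

theorem le_algebraMap_iff_exp_le {x : A} (hx : IsSelfAdjoint x) (R : ℝ) :
    x ≤ algebraMap ℝ A R ↔ exp x ≤ algebraMap ℝ A (Real.exp R) := by
  have e : cfc Real.exp x = exp x := CFC.real_exp_eq_normedSpace_exp hx
  rw [← e, cfc_le_algebraMap_iff Real.exp _ x, le_algebraMap_iff_spectrum_le]
  simp

theorem smul_le_algebraMap_smul_iff {x : A} {c : ℝ} (hc : 0 < c) (R : ℝ) :
    c • x ≤ algebraMap ℝ A (c * R) ↔ x ≤ algebraMap ℝ A R := by
  rw [Algebra.algebraMap_eq_smul_one, mul_smul, ← Algebra.algebraMap_eq_smul_one]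
  exact smul_le_smul_iff_of_pos_left hc

theorem norm_le_iff_le_and_neg_le {x : A} (hx : IsSelfAdjoint x) {R : ℝ} (hR : 0 ≤ R) :
    ‖x‖ ≤ R ↔ x ≤ algebraMap ℝ A R ∧ -x ≤ algebraMap ℝ A R := by
  constructor
  · intro h
    have h1 : algebraMap ℝ A ‖x‖ ≤ algebraMap ℝ A R := algebraMap_mono A h
    refine ⟨hx.le_algebraMap_norm_self.trans h1, ?_⟩
    have h2 := hx.neg.le_algebraMap_norm_self
    rw [norm_neg] at h2
    exact h2.trans h1
  · rintro ⟨h1, h2⟩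
    rcases subsingleton_or_nontrivial A with h | h
    · simpa [Subsingleton.elim x 0] using hR
    · rw [le_algebraMap_iff_spectrum_le] at h1 h2
      rcases CStarAlgebra.norm_or_neg_norm_mem_spectrum hx with h3 | h3
      · exact h1 _ h3
      · refine h2 _ ?_
        rw [← spectrum.neg_eq]
        simpa using h3

theorem norm_exp_le_of_le {x : A} (hx : IsSelfAdjoint x) {R : ℝ} (h : x ≤ algebraMap ℝ A R) :
    ‖exp x‖ ≤ Real.exp R :=
  (CStarAlgebra.norm_le_iff_le_algebraMap _ (Real.exp_nonneg R) hx.exp_nonneg).2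
    ((le_algebraMap_iff_exp_le hx R).1 h)

theorem rpow_half_exp {x : A} (hx : IsSelfAdjoint x) :
    exp ((2 : ℝ) • x) ^ (1 / 2 : ℝ) = exp x := by
  rw [← CFC.sqrt_eq_rpow, ← exp_mul_exp_self, CFC.sqrt_mul_self _ hx.exp_nonneg]

theorem rpow_neg_half_exp {x : A} (hx : IsSelfAdjoint x) :
    exp ((2 : ℝ) • x) ^ (-(1 / 2) : ℝ) = exp (-x) := by
  have h := CFC.rpow_neg_mul_rpow (a := exp ((2 : ℝ) • x)) (1 / 2 : ℝ)
    (isStrictlyPositive_exp (hx.real_smul 2))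
  rw [rpow_half_exp hx] at h
  calc _ = exp ((2 : ℝ) • x) ^ (-(1 / 2) : ℝ) * (exp x * exp (-x)) := by
        rw [exp_mul_exp_neg, mul_one]
    _ = _ := by rw [← mul_assoc, h, one_mul]

end CStar

/-! ### The L²-seminorm of the trace -/

section Trace

variable {A : Type*} [CStarAlgebra A]

/-- The `L²`-seminorm `τ(x⋆x)^{1/2}`. -/
noncomputable def l2norm (τ : A →ₗ[ℂ] ℂ) (x : A) : ℝ := √(τ (star x * x)).re

theorem l2norm_nonneg (τ : A →ₗ[ℂ] ℂ) (x : A) : 0 ≤ l2norm τ x := Real.sqrt_nonneg _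

variable [PartialOrder A] [StarOrderedRing A] {τ : A →ₗ[ℂ] ℂ}

namespace IsFaithfulNormalTrace

/-- The trace as a bundled positive functional. -/
noncomputable def toPositive (hτ : IsFaithfulNormalTrace τ) : A →ₚ[ℂ] ℂ :=
  PositiveLinearMap.mk₀ τ fun x hx => by
    obtain ⟨y, rfl⟩ := CStarAlgebra.nonneg_iff_eq_star_mul_self.1 hx
    exact hτ.nonneg y

theorem l2norm_eq (hτ : IsFaithfulNormalTrace τ) (x : A) :
    l2norm τ x = ‖hτ.toPositive.toPreGNS x‖ := rfl

theorem map_nonneg (hτ : IsFaithfulNormalTrace τ) {x : A} (hx : 0 ≤ x) : 0 ≤ τ x :=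
  hτ.toPositive.map_nonneg hx

theorem re_mono (hτ : IsFaithfulNormalTrace τ) {x y : A} (h : x ≤ y) : (τ x).re ≤ (τ y).re := by
  have := (Complex.le_def.1 (hτ.map_nonneg (sub_nonneg.2 h))).1
  simpa [map_sub] using this

theorem continuous (hτ : IsFaithfulNormalTrace τ) : Continuous τ :=
  map_continuous hτ.toPositive

theorem l2norm_sq (hτ : IsFaithfulNormalTrace τ) (x : A) :
    l2norm τ x ^ 2 = (τ (star x * x)).re :=
  Real.sq_sqrt (Complex.le_def.1 (hτ.nonneg x)).1

theorem l2norm_sq_of_isSelfAdjoint (hτ : IsFaithfulNormalTrace τ) {x : A} (hx : IsSelfAdjoint x) :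
    l2norm τ x ^ 2 = (τ (x * x)).re := by
  rw [hτ.l2norm_sq, hx.star_eq]

theorem l2norm_add_le (hτ : IsFaithfulNormalTrace τ) (x y : A) :
    l2norm τ (x + y) ≤ l2norm τ x + l2norm τ y := by
  simp only [hτ.l2norm_eq, map_add]
  exact norm_add_le _ _

theorem l2norm_neg (hτ : IsFaithfulNormalTrace τ) (x : A) : l2norm τ (-x) = l2norm τ x := by
  simp only [hτ.l2norm_eq, map_neg, norm_neg]

theorem l2norm_sub_comm (hτ : IsFaithfulNormalTrace τ) (x y : A) :
    l2norm τ (x - y) = l2norm τ (y - x) := by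
  rw [← hτ.l2norm_neg, neg_sub]

theorem l2norm_sub_le (hτ : IsFaithfulNormalTrace τ) (x y z : A) :
    l2norm τ (x - z) ≤ l2norm τ (x - y) + l2norm τ (y - z) := by
  simpa using hτ.l2norm_add_le (x - y) (y - z)

theorem abs_l2norm_sub_le (hτ : IsFaithfulNormalTrace τ) (x y : A) :
    |l2norm τ x - l2norm τ y| ≤ l2norm τ (x - y) := by
  simp only [hτ.l2norm_eq, map_sub]
  exact abs_norm_sub_norm_le _ _

theorem l2norm_smul (hτ : IsFaithfulNormalTrace τ) (c : ℝ) (x : A) :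
    l2norm τ (c • x) = |c| * l2norm τ x := by
  have : c • x = (c : ℂ) • x := (Complex.coe_smul c x).symm
  rw [this]
  simp only [hτ.l2norm_eq, map_smul, norm_smul]
  simp

theorem norm_apply_le (hτ : IsFaithfulNormalTrace τ) (x y : A) :
    ‖τ (star x * y)‖ ≤ l2norm τ x * l2norm τ y :=
  norm_inner_le_norm (𝕜 := ℂ) (hτ.toPositive.toPreGNS x) (hτ.toPositive.toPreGNS y)

theorem abs_re_le (hτ : IsFaithfulNormalTrace τ) (x y : A) :
    |(τ (star x * y)).re| ≤ l2norm τ x * l2norm τ y :=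
  (Complex.abs_re_le_norm _).trans (hτ.norm_apply_le x y)

theorem l2norm_star (hτ : IsFaithfulNormalTrace τ) (x : A) : l2norm τ (star x) = l2norm τ x := by
  rw [l2norm, l2norm, star_star, hτ.tracial]

theorem l2norm_mul_le (hτ : IsFaithfulNormalTrace τ) (a x : A) :
    l2norm τ (a * x) ≤ ‖a‖ * l2norm τ x :=
  (hτ.toPositive.leftMulMapPreGNS a).le_of_opNorm_le
    (LinearMap.mkContinuous_norm_le _ (norm_nonneg a) _) (hτ.toPositive.toPreGNS x)

theorem l2norm_mul_le' (hτ : IsFaithfulNormalTrace τ) (x a : A) :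
    l2norm τ (x * a) ≤ l2norm τ x * ‖a‖ := by
  rw [← hτ.l2norm_star, star_mul, mul_comm (l2norm τ x), ← norm_star a, ← hτ.l2norm_star x]
  exact hτ.l2norm_mul_le _ _

theorem l2norm_le (hτ : IsFaithfulNormalTrace τ) (x : A) :
    l2norm τ x ≤ ‖x‖ * l2norm τ 1 := by
  simpa using hτ.l2norm_mul_le x 1

theorem eq_zero_of_l2norm (hτ : IsFaithfulNormalTrace τ) {x : A} (h : l2norm τ x = 0) : x = 0 := by
  refine hτ.faithful x (Complex.ext ?_ ?_)
  · rw [← hτ.l2norm_sq, h]; simp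
  · exact (Complex.le_def.1 (hτ.nonneg x)).2.symm

end IsFaithfulNormalTrace

end Trace

/-! ### The exponential metric increasing property -/

section Distance

variable {A : Type*} [CStarAlgebra A] [PartialOrder A] [StarOrderedRing A] {τ : A →ₗ[ℂ] ℂ}

namespace IsFaithfulNormalTrace

/-- With `P = e^{s/2} v e^{-t/2}` and `Q = e^{-s/2} v e^{t/2}`, traciality turns the right side into
`‖P‖² + ‖Q‖²` and `τ(P⋆Q)` into `τ(v²)`; Cauchy–Schwarz and `2‖P‖‖Q‖ ≤ ‖P‖² + ‖Q‖²` conclude. -/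
theorem two_mul_l2norm_sq_le (hτ : IsFaithfulNormalTrace τ) {s t v : A} (hs : IsSelfAdjoint s)
    (ht : IsSelfAdjoint t) (hv : IsSelfAdjoint v) :
    2 * l2norm τ v ^ 2 ≤ (τ (exp (-s) * v * exp t * v + exp s * v * exp (-t) * v)).re := by
  set a := exp ((1 / 2 : ℝ) • s)
  set a' := exp (-((1 / 2 : ℝ) • s))
  set b := exp ((1 / 2 : ℝ) • t)
  set b' := exp (-((1 / 2 : ℝ) • t))
  have ha : star a = a := (hs.real_smul _).exp.star_eq
  have ha' : star a' = a' := (hs.real_smul _).neg.exp.star_eq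
  have hb : star b = b := (ht.real_smul _).exp.star_eq
  have hb' : star b' = b' := (ht.real_smul _).neg.exp.star_eq
  have haa : a * a = exp s := exp_half_mul_exp_half s
  have haa' : a' * a' = exp (-s) := by
    rw [← exp_half_mul_exp_half (-s), smul_neg]
  have hbb : b * b = exp t := exp_half_mul_exp_half t
  have hbb' : b' * b' = exp (-t) := by
    rw [← exp_half_mul_exp_half (-t), smul_neg]
  have h1 : l2norm τ (a * v * b') ^ 2 = (τ (exp s * v * exp (-t) * v)).re := by
    have : star (a * v * b') * (a * v * b') = b' * v * (a * a * v * b') := by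
      simp only [star_mul, ha, hb', hv.star_eq, mul_assoc]
    rw [hτ.l2norm_sq, this, hτ.tracial, ← haa, ← hbb']
    simp only [mul_assoc]
  have h2 : l2norm τ (a' * v * b) ^ 2 = (τ (exp (-s) * v * exp t * v)).re := by
    have : star (a' * v * b) * (a' * v * b) = b * v * (a' * a' * v * b) := by
      simp only [star_mul, hb, ha', hv.star_eq, mul_assoc]
    rw [hτ.l2norm_sq, this, hτ.tracial, ← haa', ← hbb]
    simp only [mul_assoc]
  have h3 : l2norm τ v ^ 2 = (τ (star (a * v * b') * (a' * v * b))).re := by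
    have : star (a * v * b') * (a' * v * b) = b' * v * (a * a') * (v * b) := by
      simp only [star_mul, ha, hb', hv.star_eq, mul_assoc]
    rw [this, exp_mul_exp_neg, mul_one, hτ.tracial, mul_assoc, ← mul_assoc b, exp_mul_exp_neg,
      one_mul, hτ.l2norm_sq_of_isSelfAdjoint hv]
  have h4 := (le_abs_self _).trans (hτ.abs_re_le (a * v * b') (a' * v * b))
  rw [← h3] at h4
  rw [map_add, Complex.add_re, ← h1, ← h2]
  nlinarith [sq_nonneg (l2norm τ (a * v * b') - l2norm τ (a' * v * b))]

/-- The real part of the trace as a continuous real functional. -/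
noncomputable def reCLM (hτ : IsFaithfulNormalTrace τ) : A →L[ℝ] ℝ :=
  Complex.reCLM.comp ((⟨τ, hτ.continuous⟩ : A →L[ℂ] ℂ).restrictScalars ℝ)

theorem reCLM_apply (hτ : IsFaithfulNormalTrace τ) (x : A) : hτ.reCLM x = (τ x).re := rfl

/-- The `L²`-distance of logarithms is controlled by the symmetrised Stein divergence. -/
theorem l2norm_sub_sq_le (hτ : IsFaithfulNormalTrace τ) {s t : A} (hs : IsSelfAdjoint s)
    (ht : IsSelfAdjoint t) :
    l2norm τ (t - s) ^ 2 ≤ (τ (exp (-s) * exp t + exp s * exp (-t) - 2)).re := by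
  set v := t - s with hv_def
  have hv : IsSelfAdjoint v := ht.sub hs
  -- `G 0 = 0`, and by the previous lemma at `u • s`, `u • t` the real trace of `G` grows at rate at
  -- least `2‖v‖²`. At `u = 1/2` this reads `Re τ(Wv) ≥ ‖v‖²`, and `‖W⋆‖²` is exactly the divergence
  -- on the right.
  let G : ℝ → A := fun u =>
    (exp (u • (-s)) * exp (u • t) - exp (u • s) * exp (u • (-t))) * v
  let G' : ℝ → A := fun u =>
    exp (-(u • s)) * v * exp (u • t) * v + exp (u • s) * v * exp (-(u • t)) * v
  have hG : ∀ u, HasDerivAt G (G' u) u := by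
    intro u
    have h1 := (hasDerivAt_exp_smul_const (𝕂 := ℝ) (-s) u).mul
      (hasDerivAt_exp_smul_const' (𝕂 := ℝ) t u)
    have h2 := (hasDerivAt_exp_smul_const (𝕂 := ℝ) s u).mul
      (hasDerivAt_exp_smul_const' (𝕂 := ℝ) (-t) u)
    refine ((h1.sub h2).mul_const v).congr_deriv ?_
    simp only [G', smul_neg, hv_def]
    noncomm_ring
  have hd : ∀ u, HasDerivAt (fun u => hτ.reCLM (G u) - 2 * l2norm τ v ^ 2 * u)
      (hτ.reCLM (G' u) - 2 * l2norm τ v ^ 2) u := by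
    intro u
    have h1 := hτ.reCLM.hasFDerivAt.comp_hasDerivAt u (hG u)
    have h2 := (hasDerivAt_id u).const_mul (2 * l2norm τ v ^ 2)
    rw [mul_one] at h2
    exact h1.sub h2
  have hmono : Monotone (fun u => hτ.reCLM (G u) - 2 * l2norm τ v ^ 2 * u) := by
    refine monotone_of_deriv_nonneg (fun u => (hd u).differentiableAt) fun u => ?_
    rw [(hd u).deriv, sub_nonneg]
    exact hτ.two_mul_l2norm_sq_le (hs.real_smul u) (ht.real_smul u) hv
  have hle := hmono (show (0 : ℝ) ≤ 1 / 2 by norm_num)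
  set a := exp ((1 / 2 : ℝ) • s) with ha_def
  set a' := exp ((1 / 2 : ℝ) • (-s)) with ha'_def
  set b := exp ((1 / 2 : ℝ) • t) with hb_def
  set b' := exp ((1 / 2 : ℝ) • (-t)) with hb'_def
  have ha : star a = a := (hs.real_smul _).exp.star_eq
  have ha' : star a' = a' := (hs.neg.real_smul _).exp.star_eq
  have hb : star b = b := (ht.real_smul _).exp.star_eq
  have hb' : star b' = b' := (ht.neg.real_smul _).exp.star_eq
  have hG0 : G 0 = 0 := by simp [G]
  have hG1 : G (1 / 2) = (a' * b - a * b') * v := rfl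
  simp only [hG0, hG1, map_zero, mul_zero, sub_zero, reCLM_apply] at hle
  set W := a' * b - a * b' with hW
  have h1 : l2norm τ v ^ 2 ≤ l2norm τ (star W) * l2norm τ v := by
    have := (le_abs_self _).trans (hτ.abs_re_le (star W) v)
    rw [star_star] at this
    linarith
  have h2 : l2norm τ v ≤ l2norm τ (star W) := by
    rcases (l2norm_nonneg τ v).eq_or_lt with h | h
    · rw [← h]; exact l2norm_nonneg _ _
    · rw [sq] at h1; exact le_of_mul_le_mul_right h1 h
  have h3 : l2norm τ (star W) ^ 2 = (τ (exp (-s) * exp t + exp s * exp (-t) - 2)).re := by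
    have e1 : a * a' = 1 := by rw [ha'_def, smul_neg]; exact exp_mul_exp_neg _
    have e2 : a' * a = 1 := by rw [ha'_def, smul_neg]; exact exp_neg_mul_exp _
    have e3 : b * b' = 1 := by rw [hb'_def, smul_neg]; exact exp_mul_exp_neg _
    have e4 : b' * b = 1 := by rw [hb'_def, smul_neg]; exact exp_neg_mul_exp _
    have e5 : W * star W = a' * (b * b) * a' - a' * (b * b') * a - a * (b' * b) * a'
        + a * (b' * b') * a := by
      simp only [hW, star_sub, star_mul, ha, ha', hb, hb']
      noncomm_ring
    have e6 : τ (a' * (b * b) * a') = τ (exp (-s) * exp t) := by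
      rw [hτ.tracial, ← mul_assoc, exp_half_mul_exp_half, exp_half_mul_exp_half]
    have e7 : τ (a * (b' * b') * a) = τ (exp s * exp (-t)) := by
      rw [hτ.tracial, ← mul_assoc, exp_half_mul_exp_half, exp_half_mul_exp_half]
    rw [hτ.l2norm_sq, star_star, e5, e3, e4, mul_one, mul_one, e1, e2]
    simp only [map_add, map_sub, e6, e7, show (2 : A) = 1 + 1 by norm_num]
    ring_nf
  rw [← h3]
  exact pow_le_pow_left₀ (l2norm_nonneg _ _) h2 2

/-- The logarithm is `L²`-Lipschitz on norm-bounded sets with bounded inverses. -/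
theorem l2norm_sub_sq_le_of_norm_le (hτ : IsFaithfulNormalTrace τ) {s t : A}
    (hs : IsSelfAdjoint s) (ht : IsSelfAdjoint t) {C : ℝ} (hsC : ‖exp (-s)‖ ≤ C)
    (htC : ‖exp (-t)‖ ≤ C) :
    l2norm τ (t - s) ≤ C * l2norm τ (exp t - exp s) := by
  have hC : 0 ≤ C := (norm_nonneg _).trans hsC
  set z := exp t - exp s
  have hz : star z = z := (ht.exp.sub hs.exp).star_eq
  have hs' : star (exp (-s)) = exp (-s) := hs.neg.exp.star_eq
  -- The divergence is quadratic in `z = e^t - e^s` up to a commutator, which the trace kills.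
  have h1 : exp (-s) * exp t + exp s * exp (-t) - 2 =
      exp (-s) * z * (exp (-t) * z) + (exp s * exp (-t) - exp (-t) * exp s) := by
    have e : exp (-s) * z * (exp (-t) * z) = exp (-s) * exp t * exp (-t) * exp t
        - exp (-s) * (exp t * exp (-t)) * exp s - exp (-s) * exp s * (exp (-t) * exp t)
        + (exp (-s) * exp s) * exp (-t) * exp s := by
      simp only [z]; noncomm_ring
    rw [e, mul_assoc _ (exp t), exp_mul_exp_neg, exp_neg_mul_exp, exp_neg_mul_exp]
    simp only [mul_one, one_mul, exp_neg_mul_exp, show (2 : A) = 1 + 1 by norm_num]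
    abel
  have h2 : (τ (exp (-s) * exp t + exp s * exp (-t) - 2)).re =
      (τ (star (z * exp (-s)) * (exp (-t) * z))).re := by
    rw [h1, map_add, map_sub, hτ.tracial (exp s) (exp (-t)), sub_self, add_zero, star_mul, hz, hs']
  have h3 := hτ.l2norm_sub_sq_le hs ht
  rw [h2] at h3
  have h4 := h3.trans ((le_abs_self _).trans (hτ.abs_re_le _ _))
  have h5 : l2norm τ (z * exp (-s)) ≤ C * l2norm τ z := by
    rw [mul_comm]
    exact (hτ.l2norm_mul_le' _ _).trans (mul_le_mul_of_nonneg_left hsC (l2norm_nonneg _ _))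
  have h6 : l2norm τ (exp (-t) * z) ≤ C * l2norm τ z :=
    (hτ.l2norm_mul_le _ _).trans (mul_le_mul_of_nonneg_right htC (l2norm_nonneg _ _))
  have h7 : 0 ≤ C * l2norm τ z := mul_nonneg hC (l2norm_nonneg _ _)
  refine le_of_sq_le_sq ?_ h7
  calc _ ≤ _ := h4
    _ ≤ (C * l2norm τ z) * (C * l2norm τ z) := mul_le_mul h5 h6 (l2norm_nonneg _ _) h7
    _ = _ := (sq _).symm

/-- The exponential metric increasing property. -/
theorem l2norm_sub_le_of_exp_eq (hτ : IsFaithfulNormalTrace τ) {s t z : A} (hs : IsSelfAdjoint s)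
    (ht : IsSelfAdjoint t) (hz : IsSelfAdjoint z)
    (h : exp t = exp ((1 / 2 : ℝ) • s) * exp z * exp ((1 / 2 : ℝ) • s)) :
    l2norm τ (t - s) ≤ l2norm τ z := by
  set a := exp ((1 / 2 : ℝ) • s) with ha_def
  set a' := exp (-((1 / 2 : ℝ) • s)) with ha'_def
  have haa' : a * a' = 1 := exp_mul_exp_neg _
  have ha'a : a' * a = 1 := exp_neg_mul_exp _
  -- The geodesic from `e^s` to `e^t` in logarithmic coordinates. Under the trace the divergence
  -- between `c u` and `c (u + w)` collapses to `τ(e^{wz} + e^{-wz} - 2)`, about `w² τ(z²)`. Summing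
  -- `n` steps of size `1/n` and letting `n → ∞` avoids differentiating the logarithm.
  let c : ℝ → A := fun u => CFC.log (a * exp (u • z) * a)
  have hc : ∀ u, IsSelfAdjoint (c u) := fun u => IsSelfAdjoint.log
  have hec : ∀ u, exp (c u) = a * exp (u • z) * a := fun u =>
    CFC.exp_log _ (isStrictlyPositive_exp_conj (hs.real_smul _)
      (isStrictlyPositive_exp (hz.real_smul _)))
  have hec' : ∀ u, exp (-c u) = a' * exp (-(u • z)) * a' := by
    intro u
    have h1 : a * exp (u • z) * a * (a' * exp (-(u • z)) * a') = 1 := by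
      calc _ = a * (exp (u • z) * (a * a') * exp (-(u • z))) * a' := by simp only [mul_assoc]
        _ = 1 := by rw [haa', mul_one, exp_mul_exp_neg, mul_one, haa']
    calc exp (-c u) = exp (-c u) * (exp (c u) * (a' * exp (-(u • z)) * a')) := by
          rw [hec, h1, mul_one]
      _ = _ := by rw [← mul_assoc, exp_neg_mul_exp, one_mul]
  have hstep : ∀ u w : ℝ, |w| * ‖z‖ ≤ 1 →
      l2norm τ (c (u + w) - c u) ≤ |w| * (√(1 + (|w| * ‖z‖) ^ 2) * l2norm τ z) := by
    intro u w hw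
    have hwz : ‖w • z‖ = |w| * ‖z‖ := by rw [norm_smul, Real.norm_eq_abs]
    have h1 := hτ.l2norm_sub_sq_le (hc u) (hc (u + w))
    have e1 : exp (-c u) * exp (c (u + w)) = a' * (exp (w • z) * a) := by
      rw [hec, hec']
      calc _ = a' * (exp (-(u • z)) * (a' * a) * exp ((u + w) • z)) * a := by
            simp only [mul_assoc]
        _ = _ := by
            rw [ha'a, mul_one, ← neg_smul, exp_smul_mul_exp_smul, neg_add_cancel_left, mul_assoc]
    have e2 : exp (c u) * exp (-c (u + w)) = a * (exp (-(w • z)) * a') := by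
      rw [hec, hec']
      calc _ = a * (exp (u • z) * (a * a') * exp (-((u + w) • z))) * a' := by
            simp only [mul_assoc]
        _ = _ := by
            rw [haa', mul_one, ← neg_smul, exp_smul_mul_exp_smul, neg_add, add_neg_cancel_left,
              mul_assoc, neg_smul]
    have e3 : τ (exp (-c u) * exp (c (u + w)) + exp (c u) * exp (-c (u + w)) - 2) =
        τ (exp (w • z) + exp (-(w • z)) - 2) := by
      rw [map_sub, map_add, e1, e2, hτ.tracial a', hτ.tracial a, mul_assoc, mul_assoc, haa', ha'a,
        mul_one, mul_one, map_sub, map_add]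
    rw [e3] at h1
    have h2 := h1.trans (hτ.re_mono
      (exp_add_exp_neg_sub_two_le (hz.real_smul w) (hwz.le.trans hw)))
    have e4 : (τ ((1 + ‖w • z‖ ^ 2) • (w • z * w • z))).re =
        (|w| * (√(1 + (|w| * ‖z‖) ^ 2) * l2norm τ z)) ^ 2 := by
      rw [← reCLM_apply hτ, map_smul, reCLM_apply, ← hτ.l2norm_sq_of_isSelfAdjoint (hz.real_smul w),
        hτ.l2norm_smul, hwz, smul_eq_mul]
      linear_combination (-(|w| * l2norm τ z) ^ 2) *
        Real.sq_sqrt (show 0 ≤ 1 + (|w| * ‖z‖) ^ 2 by positivity)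
    rw [e4] at h2
    refine le_of_sq_le_sq h2 ?_
    have := l2norm_nonneg τ z
    positivity
  have hsub : ∀ (w : ℝ), |w| * ‖z‖ ≤ 1 → ∀ n : ℕ, l2norm τ (c (n * w) - c 0) ≤
      n * (|w| * (√(1 + (|w| * ‖z‖) ^ 2) * l2norm τ z)) := by
    intro w hw n
    induction n with
    | zero => simp [l2norm]
    | succ n ih =>
      have h1 := hstep (n * w) w hw
      have h2 := hτ.l2norm_sub_le (c (n * w + w)) (c (n * w)) (c 0)
      have e : ((n + 1 : ℕ) : ℝ) * w = n * w + w := by push_cast; ring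
      rw [e]
      push_cast
      linarith
  have hc0 : c 0 = s := exp_injective (hc 0) hs (by
    rw [hec, zero_smul, exp_zero, mul_one, exp_half_mul_exp_half])
  have hc1 : c 1 = t := exp_injective (hc 1) ht (by rw [hec, one_smul, h])
  have hlim : Filter.Tendsto (fun n : ℕ => √(1 + ((n : ℝ)⁻¹ * ‖z‖) ^ 2) * l2norm τ z)
      Filter.atTop (nhds (l2norm τ z)) := by
    have h0 : Filter.Tendsto (fun n : ℕ => (n : ℝ)⁻¹) Filter.atTop (nhds 0) :=
      tendsto_inv_atTop_nhds_zero_nat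
    have hcont : Continuous (fun x : ℝ => √(1 + (x * ‖z‖) ^ 2) * l2norm τ z) := by fun_prop
    have := (hcont.tendsto 0).comp h0
    simpa using! this
  refine ge_of_tendsto hlim ?_
  obtain ⟨n₀, hn₀⟩ := exists_nat_gt ‖z‖
  filter_upwards [Filter.eventually_ge_atTop (max n₀ 1)] with n hn
  have hn1 : (0 : ℝ) < n := by
    have := (le_max_right n₀ 1).trans hn
    exact_mod_cast this
  have hn2 : ‖z‖ ≤ n := hn₀.le.trans (by exact_mod_cast (le_max_left n₀ 1).trans hn)
  have habs : |(n : ℝ)⁻¹| = (n : ℝ)⁻¹ := abs_of_pos (inv_pos.2 hn1)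
  have h1 := hsub (n : ℝ)⁻¹ (by rw [habs, inv_mul_le_iff₀ hn1, mul_one]; exact hn2) n
  rw [mul_inv_cancel₀ hn1.ne', hc0, hc1, habs, ← mul_assoc, mul_inv_cancel₀ hn1.ne', one_mul] at h1
  exact h1

/-- The `L²`-norm of the logarithm is invariant under unitary conjugation. -/
theorem l2norm_eq_of_exp_eq_conj (hτ : IsFaithfulNormalTrace τ) {x y u v : A}
    (hx : IsSelfAdjoint x) (hy : IsSelfAdjoint y) (huv : u * v = 1) (hvu : v * u = 1)
    (hu : star u = v) (h : exp y = u * exp x * v) : l2norm τ y = l2norm τ x := by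
  have hx' : IsSelfAdjoint (u * x * v) := by
    rw [← hu]; exact hx.conjugate u
  have h1 : y = u * x * v := exp_injective hy hx' (by rw [h, exp_conj huv hvu])
  have h2 : l2norm τ y ^ 2 = l2norm τ x ^ 2 := by
    rw [hτ.l2norm_sq_of_isSelfAdjoint hx, hτ.l2norm_sq_of_isSelfAdjoint hy, h1,
      hτ.tracial (u * x * v)]
    have : u * x * v * (u * x * v) = u * (x * (v * u) * x * v) := by simp only [mul_assoc]
    rw [this, hvu, mul_one, hτ.tracial, mul_assoc, hvu, mul_one]
  exact (pow_left_inj₀ (l2norm_nonneg _ _) (l2norm_nonneg _ _) two_ne_zero).1 h2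

end IsFaithfulNormalTrace

end Distance

/-! ### Strong limits in a von Neumann algebra -/

section StrongLimits

open Filter Topology

variable {K : Type*} [NormedAddCommGroup K] [InnerProductSpace ℂ K] [CompleteSpace K]
  {N : VonNeumannAlgebra K}

/-- A sequence in a von Neumann algebra that is strongly Cauchy converges strongly in it. -/
theorem exists_strong_limit {x : ℕ → N}
    (hx : ∀ ξ : K, CauchySeq fun n => (x n : K →L[ℂ] K) ξ) :
    ∃ y : N, ∀ ξ : K, Tendsto (fun n => (x n : K →L[ℂ] K) ξ) atTop (𝓝 ((y : K →L[ℂ] K) ξ)) := by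
  choose f hf using fun ξ => cauchySeq_tendsto_of_complete (hx ξ)
  let T : K →L[ℂ] K := continuousLinearMapOfTendsto (fun n => (x n : K →L[ℂ] K))
    (f := f) (l := atTop) (tendsto_pi_nhds.2 hf)
  have hT : ∀ ξ, T ξ = f ξ := fun _ => rfl
  -- Bicommutant theorem: a strong limit still commutes with the commutant.
  have hmem : T ∈ N := by
    rw [← N.commutant_commutant, VonNeumannAlgebra.mem_commutant_iff]
    intro g hg
    rw [VonNeumannAlgebra.mem_commutant_iff] at hg
    ext ξ
    refine tendsto_nhds_unique ((g.continuous.tendsto _).comp (hf ξ)) ?_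
    refine (hf (g ξ)).congr fun n => ?_
    have := congrArg (fun S : K →L[ℂ] K => S ξ) (hg _ (x n).2)
    simpa using this
  exact ⟨⟨T, hmem⟩, hf⟩

theorem strong_limit_le {x : ℕ → N} {y c : N}
    (hx : ∀ ξ : K, Tendsto (fun n => (x n : K →L[ℂ] K) ξ) atTop (𝓝 ((y : K →L[ℂ] K) ξ)))
    (h : ∀ᶠ n in atTop, x n ≤ c) : y ≤ c := by
  change (y : K →L[ℂ] K) ≤ (c : K →L[ℂ] K)
  rw [ContinuousLinearMap.le_def, ContinuousLinearMap.isPositive_iff_complex]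
  intro ξ
  have hlim : Tendsto (fun n => inner ℂ (((c : K →L[ℂ] K) - (x n : K →L[ℂ] K)) ξ) ξ) atTop
      (𝓝 (inner ℂ (((c : K →L[ℂ] K) - (y : K →L[ℂ] K)) ξ) ξ)) := by
    simp only [sub_apply]
    exact (tendsto_const_nhds.sub (hx ξ)).inner tendsto_const_nhds
  have hpos : ∀ᶠ n in atTop, ((inner ℂ (((c : K →L[ℂ] K) - (x n : K →L[ℂ] K)) ξ) ξ).re : ℂ) =
      inner ℂ (((c : K →L[ℂ] K) - (x n : K →L[ℂ] K)) ξ) ξ ∧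
      0 ≤ (inner ℂ (((c : K →L[ℂ] K) - (x n : K →L[ℂ] K)) ξ) ξ).re := by
    filter_upwards [h] with n hn
    have hn' : (x n : K →L[ℂ] K) ≤ (c : K →L[ℂ] K) := hn
    rw [ContinuousLinearMap.le_def, ContinuousLinearMap.isPositive_iff_complex] at hn'
    exact hn' ξ
  have hre := (Complex.continuous_re.tendsto _).comp hlim
  refine ⟨?_, ge_of_tendsto hre (hpos.mono fun n hn => hn.2)⟩
  refine tendsto_nhds_unique ((Complex.continuous_ofReal.tendsto _).comp hre) ?_
  exact hlim.congr' (hpos.mono fun n hn => hn.1.symm)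

theorem strong_limit_isSelfAdjoint {x : ℕ → N} {y : N}
    (hx : ∀ ξ : K, Tendsto (fun n => (x n : K →L[ℂ] K) ξ) atTop (𝓝 ((y : K →L[ℂ] K) ξ)))
    (h : ∀ n, IsSelfAdjoint (x n)) : IsSelfAdjoint y := by
  have hy : IsSelfAdjoint (y : K →L[ℂ] K) := by
    rw [ContinuousLinearMap.isSelfAdjoint_iff_isSymmetric]
    intro ξ η
    have h1 := (hx ξ).inner (𝕜 := ℂ) (tendsto_const_nhds (x := η))
    have h2 := (tendsto_const_nhds (x := ξ)).inner (𝕜 := ℂ) (hx η)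
    refine tendsto_nhds_unique h1 (h2.congr fun n => ?_)
    have hn : IsSelfAdjoint (x n : K →L[ℂ] K) := congrArg Subtype.val (h n)
    rw [ContinuousLinearMap.isSelfAdjoint_iff_isSymmetric] at hn
    exact (hn ξ η).symm
  exact Subtype.ext hy

theorem norm_le_of_strong_limit {x : ℕ → N} {y : N} {C : ℝ} (hC : 0 ≤ C)
    (hx : ∀ ξ : K, Tendsto (fun n => (x n : K →L[ℂ] K) ξ) atTop (𝓝 ((y : K →L[ℂ] K) ξ)))
    (h : ∀ᶠ n in atTop, ‖x n‖ ≤ C) : ‖y‖ ≤ C := by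
  refine ContinuousLinearMap.opNorm_le_bound _ hC fun ξ => ?_
  refine le_of_tendsto (hx ξ).norm ?_
  filter_upwards [h] with n hn
  exact (x n : K →L[ℂ] K).le_of_opNorm_le hn ξ

/-- This is `D² ≤ D`. It upgrades convergence of the quadratic forms of a monotone sequence to
strong convergence. -/
theorem norm_apply_sq_le_of_nonneg_of_le_one {D : K →L[ℂ] K} (h0 : 0 ≤ D) (h1 : D ≤ 1) (ξ : K) :
    ‖D ξ‖ ^ 2 ≤ (inner ℂ (D ξ) ξ).re := by
  have h2 : D ^ 2 ≤ D ^ 1 := CStarAlgebra.pow_antitone h0 h1 one_le_two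
  rw [pow_one, sq, ContinuousLinearMap.le_def] at h2
  have h3 := h2.re_inner_nonneg_left ξ
  have h4 : IsSelfAdjoint D := h0.isSelfAdjoint
  rw [ContinuousLinearMap.isSelfAdjoint_iff_isSymmetric] at h4
  have h5 : inner ℂ ((D * D) ξ) ξ = inner ℂ (D ξ) (D ξ) := h4 (D ξ) ξ
  rw [sub_apply, inner_sub_left, h5, map_sub, inner_self_eq_norm_sq] at h3
  simpa using h3

/-- Vigier's theorem for increasing sequences in the order interval `[0, 1]`. -/
theorem exists_strong_limit_of_monotone {x : ℕ → N} (hx : Monotone x) (h0 : ∀ n, 0 ≤ x n)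
    (h1 : ∀ n, x n ≤ 1) :
    ∃ y : N, (∀ ξ : K, Tendsto (fun n => (x n : K →L[ℂ] K) ξ) atTop (𝓝 ((y : K →L[ℂ] K) ξ))) ∧
      IsLUB (Set.range x) y := by
  have hcs : ∀ ξ : K, CauchySeq fun n => (x n : K →L[ℂ] K) ξ := by
    intro ξ
    let q : ℕ → ℝ := fun n => (inner ℂ ((x n : K →L[ℂ] K) ξ) ξ).re
    have hsub : ∀ m n, m ≤ n →
        ‖(x n : K →L[ℂ] K) ξ - (x m : K →L[ℂ] K) ξ‖ ^ 2 ≤ q n - q m := by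
      intro m n hmn
      have e0 : 0 ≤ x n - x m := sub_nonneg.2 (hx hmn)
      have e1 : x n - x m ≤ 1 := (sub_le_self _ (h0 m)).trans (h1 n)
      have := norm_apply_sq_le_of_nonneg_of_le_one (D := ((x n - x m : N) : K →L[ℂ] K)) e0 e1 ξ
      have e2 : ((x n - x m : N) : K →L[ℂ] K) ξ =
        (x n : K →L[ℂ] K) ξ - (x m : K →L[ℂ] K) ξ := rfl
      rw [e2, inner_sub_left, Complex.sub_re] at this
      exact this
    have hq : Monotone q := fun m n hmn => by
      have := (sq_nonneg _).trans (hsub m n hmn)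
      linarith
    have hqb : BddAbove (Set.range q) := by
      refine ⟨‖ξ‖ * ‖ξ‖, ?_⟩
      rintro _ ⟨n, rfl⟩
      have hn : ‖x n‖ ≤ 1 := (CStarAlgebra.norm_le_one_iff_of_nonneg _ (h0 n)).2 (h1 n)
      refine (Complex.re_le_norm _).trans ((norm_inner_le_norm _ _).trans ?_)
      gcongr
      simpa using (x n : K →L[ℂ] K).le_of_opNorm_le hn ξ
    have hqc : CauchySeq q := (tendsto_atTop_ciSup hq hqb).cauchySeq
    rw [Metric.cauchySeq_iff'] at hqc ⊢
    intro ε hε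
    obtain ⟨n₀, hn₀⟩ := hqc (ε ^ 2) (by positivity)
    refine ⟨n₀, fun n hn => ?_⟩
    have e1 := hsub n₀ n hn
    have e2 := hn₀ n hn
    rw [Real.dist_eq] at e2
    rw [dist_eq_norm]
    exact lt_of_pow_lt_pow_left₀ 2 hε.le (e1.trans_lt ((le_abs_self _).trans_lt e2))
  obtain ⟨y, hy⟩ := exists_strong_limit hcs
  refine ⟨y, hy, ?_, ?_⟩
  · rintro _ ⟨n, rfl⟩
    have hneg : ∀ ξ : K, Tendsto (fun m => ((-x m : N) : K →L[ℂ] K) ξ) atTop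
        (𝓝 (((-y : N) : K →L[ℂ] K) ξ)) := fun ξ => (hy ξ).neg
    have := strong_limit_le (c := -x n) hneg (by
      filter_upwards [eventually_ge_atTop n] with m hm
      exact neg_le_neg (hx hm))
    exact neg_le_neg_iff.1 this
  · intro c hc
    exact strong_limit_le hy (Eventually.of_forall fun n => hc ⟨n, rfl⟩)

end StrongLimits

/-! ### Resolvents `(1 + S)⁻¹` as cutoffs -/

section Resolvent

variable {A : Type*} [CStarAlgebra A] [PartialOrder A] [StarOrderedRing A]

theorem isStrictlyPositive_one_add {S : A} (hS : 0 ≤ S) : IsStrictlyPositive (1 + S) :=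
  isStrictlyPositive_one.add_nonneg hS

theorem inverse_one_add_nonneg {S : A} (hS : 0 ≤ S) : 0 ≤ Ring.inverse (1 + S) :=
  (isStrictlyPositive_one_add hS).ringInverse.nonneg

theorem inverse_one_add_antitone {S T : A} (hS : 0 ≤ S) (h : S ≤ T) :
    Ring.inverse (1 + T) ≤ Ring.inverse (1 + S) :=
  CStarAlgebra.ringInverse_le_ringInverse (add_le_add_right h 1) (isStrictlyPositive_one_add hS)

theorem inverse_one_add_le_one {S : A} (hS : 0 ≤ S) : Ring.inverse (1 + S) ≤ 1 := by
  simpa using inverse_one_add_antitone le_rfl hS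

/-- With `r = (1 + S)⁻¹`, the difference `S - (1 - r)` is `S r S`. The trace of the cutoff defect `1
- r` is thus controlled by that of `S`. -/
theorem one_sub_inverse_one_add_le {S : A} (hS : 0 ≤ S) : 1 - Ring.inverse (1 + S) ≤ S := by
  have hu := (isStrictlyPositive_one_add hS).isUnit
  have h1 : (1 + S) * Ring.inverse (1 + S) = 1 := Ring.mul_inverse_cancel _ hu
  have h2 : Ring.inverse (1 + S) * (1 + S) = 1 := Ring.inverse_mul_cancel _ hu
  set r := Ring.inverse (1 + S)
  have h3 : 0 ≤ star S * r * S := star_left_conjugate_nonneg (inverse_one_add_nonneg hS) S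
  rw [hS.isSelfAdjoint.star_eq] at h3
  have h4 : S * r * S = S - (1 - r) := by
    have e1 : S * r = 1 - r := by rw [← h1]; noncomm_ring
    have e2 : r * S = 1 - r := by rw [← h2]; noncomm_ring
    rw [e1, sub_mul, e2, one_mul]
  rw [h4] at h3
  exact sub_nonneg.1 h3

/-- With `r = (1 + S)⁻¹`, the squared norm is `‖r D² r‖`, and `r D² r ≤ r (1 + S) r = r ≤ 1`. One
resolvent tames every `D` with `D² ≤ S`; it does the work of a spectral projection in Egorov's
theorem. -/
theorem norm_mul_inverse_one_add_le {S D : A} (hS : 0 ≤ S) (hD : IsSelfAdjoint D)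
    (h : D * D ≤ S) : ‖D * Ring.inverse (1 + S)‖ ≤ 1 := by
  have hu := (isStrictlyPositive_one_add hS).isUnit
  have h2 : Ring.inverse (1 + S) * (1 + S) = 1 := Ring.inverse_mul_cancel _ hu
  have hr1 := inverse_one_add_le_one hS
  have hr0 := inverse_one_add_nonneg hS
  set r := Ring.inverse (1 + S)
  have hrs : star r = r := hr0.isSelfAdjoint.star_eq
  have h3 : D * D ≤ 1 + S := h.trans (le_add_of_nonneg_left zero_le_one)
  have h4 := star_left_conjugate_le_conjugate h3 r
  rw [hrs, h2, one_mul] at h4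
  have h5 : star (D * r) * (D * r) = r * (D * D) * r := by
    rw [star_mul, hrs, hD.star_eq]; simp only [mul_assoc]
  have h6 : ‖star (D * r) * (D * r)‖ ≤ 1 := by
    rw [CStarAlgebra.norm_le_one_iff_of_nonneg _ (star_mul_self_nonneg _), h5]
    exact h4.trans hr1
  rw [CStarRing.norm_star_mul_self] at h6
  nlinarith [norm_nonneg (D * r)]

theorem IsFaithfulNormalTrace.eq_zero_of_nonneg_of_re_nonpos {τ : A →ₗ[ℂ] ℂ}
    (hτ : IsFaithfulNormalTrace τ) {x : A} (hx : 0 ≤ x) (h : (τ x).re ≤ 0) : x = 0 := by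
  obtain ⟨y, rfl⟩ := CStarAlgebra.nonneg_iff_eq_star_mul_self.1 hx
  rw [← hτ.l2norm_sq] at h
  have : y = 0 := hτ.eq_zero_of_l2norm (by nlinarith [l2norm_nonneg τ y])
  simp [this]

end Resolvent

/-! ### L²-completeness of norm-bounded sets -/

section Completeness

open Filter Topology

variable {K : Type*} [NormedAddCommGroup K] [InnerProductSpace ℂ K] [CompleteSpace K]
  {N : VonNeumannAlgebra K} {τ : N →ₗ[ℂ] ℂ}

namespace IsFaithfulNormalTrace

/-- For an increasing sequence of positive elements, the trace bound passes to the strong limit. -/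
theorem re_le_of_isLUB (hτ : IsFaithfulNormalTrace τ) {x : ℕ → N} (hx : Monotone x)
    (h0 : ∀ n, 0 ≤ x n) {y : N} (hy : IsLUB (Set.range x) y) {C : ℝ}
    (hC : ∀ n, (τ (x n)).re ≤ C) : (τ y).re ≤ C := by
  have h1 := hτ.normal (Set.range x) y (Set.range_nonempty _)
    (by rintro _ ⟨n, rfl⟩; exact h0 n) hx.directed_le.directedOn_range hy
  refine h1.2 ?_
  rintro _ ⟨_, ⟨n, rfl⟩, rfl⟩
  exact hC n

/-- A noncommutative Egorov-type lemma: square-summable selfadjoint elements are uniformly bounded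
after cutting down by elements `1 - α k` that increase strongly to `1`. -/
theorem exists_uniform_cutoff (hτ : IsFaithfulNormalTrace τ) {D : ℕ → N}
    (hD : ∀ n, IsSelfAdjoint (D n)) (hDτ : ∀ n, (τ (D n * D n)).re ≤ (1 / 4) ^ n) :
    ∃ α : ℕ → N, (∀ k, 0 ≤ α k) ∧ (∀ k, α k ≤ 1) ∧ (∀ k, (τ (α k)).re ≤ 2 * (1 / 4) ^ k) ∧
      (∀ k n, k ≤ n → ‖D n * (1 - α k)‖ ≤ 1) ∧
      ∀ ξ : K, Tendsto (fun k => (α k : K →L[ℂ] K) ξ) atTop (𝓝 0) := by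
  have hDD : ∀ n, 0 ≤ D n * D n := fun n => by
    have := star_mul_self_nonneg (D n)
    rwa [(hD n).star_eq] at this
  -- The tail sums need not converge as `m → ∞`, but their defects `a k m = 1 - (1 + S k m)⁻¹`
  -- increase inside `[0, 1]`; `α k` is their supremum, and normality carries the trace bound over
  -- to it.
  let S : ℕ → ℕ → N := fun k m => ∑ i ∈ Finset.Ico k m, D i * D i
  have hS0 : ∀ k m, 0 ≤ S k m := fun k m => Finset.sum_nonneg fun i _ => hDD i
  have hSm : ∀ k, Monotone (S k) := fun k m m' h =>
    Finset.sum_le_sum_of_subset_of_nonneg (Finset.Ico_subset_Ico_right h) fun i _ _ => hDD i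
  have hSk : ∀ m, Antitone (fun k => S k m) := fun m k k' h =>
    Finset.sum_le_sum_of_subset_of_nonneg (Finset.Ico_subset_Ico_left h) fun i _ _ => hDD i
  have hSτ : ∀ k m, (τ (S k m)).re ≤ 2 * (1 / 4) ^ k := by
    intro k m
    have h1 : (τ (S k m)).re ≤ ∑ i ∈ Finset.Ico k m, (1 / 4 : ℝ) ^ i := by
      simp only [S, map_sum, Complex.re_sum]
      exact Finset.sum_le_sum fun i _ => hDτ i
    refine h1.trans ?_
    have h2 : ∀ m, ∑ i ∈ Finset.Ico k m, (1 / 4 : ℝ) ^ i ≤ 2 * (1 / 4) ^ k := by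
      intro m
      have := geom_sum_Ico_le_of_lt_one (x := (1 / 4 : ℝ)) (m := k) (n := m) (by norm_num)
        (by norm_num)
      refine this.trans ?_
      rw [div_le_iff₀ (by norm_num)]
      nlinarith [pow_pos (show (0 : ℝ) < 1 / 4 by norm_num) k]
    exact h2 m
  let a : ℕ → ℕ → N := fun k m => 1 - Ring.inverse (1 + S k m)
  have ha0 : ∀ k m, 0 ≤ a k m := fun k m => sub_nonneg.2 (inverse_one_add_le_one (hS0 k m))
  have ha1 : ∀ k m, a k m ≤ 1 := fun k m => sub_le_self _ (inverse_one_add_nonneg (hS0 k m))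
  have ham : ∀ k, Monotone (a k) := fun k m m' h =>
    sub_le_sub_left (inverse_one_add_antitone (hS0 k m) (hSm k h)) 1
  have hak : ∀ m, Antitone (fun k => a k m) := fun m k k' h =>
    sub_le_sub_left (inverse_one_add_antitone (hS0 k' m) (hSk m h)) 1
  have haτ : ∀ k m, (τ (a k m)).re ≤ 2 * (1 / 4) ^ k := fun k m =>
    (hτ.re_mono (one_sub_inverse_one_add_le (hS0 k m))).trans (hSτ k m)
  choose α hα hαlub using fun k => exists_strong_limit_of_monotone (ham k) (ha0 k) (ha1 k)
  have hα0 : ∀ k, 0 ≤ α k := fun k => (ha0 k 0).trans ((hαlub k).1 ⟨0, rfl⟩)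
  have hα1 : ∀ k, α k ≤ 1 := fun k => (hαlub k).2 (by rintro _ ⟨m, rfl⟩; exact ha1 k m)
  have hατ : ∀ k, (τ (α k)).re ≤ 2 * (1 / 4) ^ k := fun k =>
    hτ.re_le_of_isLUB (ham k) (ha0 k) (hαlub k) (haτ k)
  have hαanti : Antitone α := fun k k' h => (hαlub k').2 (by
    rintro _ ⟨m, rfl⟩
    exact (hak m h).trans ((hαlub k).1 ⟨m, rfl⟩))
  refine ⟨α, hα0, hα1, hατ, ?_, ?_⟩
  · intro k n hkn
    have hlim : ∀ ξ : K, Tendsto (fun m => ((D n * (1 - a k m) : N) : K →L[ℂ] K) ξ) atTop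
        (𝓝 (((D n * (1 - α k) : N) : K →L[ℂ] K) ξ)) := fun ξ =>
      ((D n : K →L[ℂ] K).continuous.tendsto _).comp (tendsto_const_nhds.sub (hα k ξ))
    refine norm_le_of_strong_limit zero_le_one hlim ?_
    filter_upwards [eventually_gt_atTop n] with m hm
    have h1 : D n * D n ≤ S k m :=
      Finset.single_le_sum (f := fun i => D i * D i) (fun i _ => hDD i)
        (Finset.mem_Ico.2 ⟨hkn, hm⟩)
    simpa [a] using norm_mul_inverse_one_add_le (hS0 k m) (hD n) h1
  -- The strong limit `γ ≤ 1` of `1 - α k` has `τ(1 - γ)` below every `2 · 4^{-k}`, so faithfulness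
  -- forces `γ = 1`.
  · obtain ⟨γ, hγ, hγlub⟩ := exists_strong_limit_of_monotone (x := fun k => 1 - α k)
      (fun k k' h => sub_le_sub_left (hαanti h) 1) (fun k => sub_nonneg.2 (hα1 k))
      (fun k => sub_le_self _ (hα0 k))
    have hγ1 : γ ≤ 1 := hγlub.2 (by rintro _ ⟨k, rfl⟩; exact sub_le_self _ (hα0 k))
    have h1 : ∀ k, (τ (1 - γ)).re ≤ 2 * (1 / 4) ^ k := fun k => by
      refine (hτ.re_mono ?_).trans (hατ k)
      exact sub_le_comm.1 (hγlub.1 ⟨k, rfl⟩)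
    have h2 : Tendsto (fun k : ℕ => 2 * (1 / 4 : ℝ) ^ k) atTop (𝓝 (2 * 0)) :=
      (tendsto_pow_atTop_nhds_zero_of_lt_one (by norm_num) (by norm_num)).const_mul 2
    rw [mul_zero] at h2
    have h3 : 1 - γ = 0 := hτ.eq_zero_of_nonneg_of_re_nonpos (sub_nonneg.2 hγ1)
      (ge_of_tendsto' h2 h1)
    have h4 : γ = 1 := (sub_eq_zero.1 h3).symm
    intro ξ
    have h5 := (tendsto_const_nhds (x := ξ)).sub (hγ ξ)
    rw [h4] at h5
    have e1 : ξ - ((1 : N) : K →L[ℂ] K) ξ = 0 := sub_self ξ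
    rw [e1] at h5
    refine h5.congr fun k => ?_
    have e2 : ((1 - α k : N) : K →L[ℂ] K) ξ = ξ - (α k : K →L[ℂ] K) ξ := rfl
    rw [e2, sub_sub_cancel]

/-- Norm-bounded sets of selfadjoint elements are complete for the `L²`-norm. -/
theorem exists_l2_limit (hτ : IsFaithfulNormalTrace τ) {x : ℕ → N}
    (hx : ∀ n, IsSelfAdjoint (x n)) {R : ℝ} (hR : ∀ n, ‖x n‖ ≤ R)
    (hc : ∀ n, l2norm τ (x (n + 1) - x n) ^ 2 ≤ (1 / 8) ^ n) :
    ∃ y : N, IsSelfAdjoint y ∧ ‖y‖ ≤ R ∧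
      Tendsto (fun n => l2norm τ (x n - y)) atTop (𝓝 0) := by
  have hR0 : 0 ≤ R := (norm_nonneg _).trans (hR 0)
  have h2pos : (0 : ℝ) < √2 := by positivity
  set q : ℝ := (√2)⁻¹ with hq_def
  have hq0 : 0 < q := inv_pos.2 h2pos
  have hq1 : q < 1 := inv_lt_one_of_one_lt₀ (by rw [Real.lt_sqrt] <;> norm_num)
  set C : ℝ := (1 - q)⁻¹ with hC_def
  have hC0 : 0 < C := inv_pos.2 (by linarith)
  have hCq : C * (1 - q) = 1 := inv_mul_cancel₀ (by linarith)
  -- The weight splits the rate `8^{-n}`: the traces of the squares keep `4^{-n}`, while a bound `‖D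
  -- n (1 - α k)‖ ≤ 1` still makes the cut-off increments of `x` at most `q^n` with `q = 1/√2`.
  let D : ℕ → N := fun n => (√2 ^ n) • (x (n + 1) - x n)
  have hD : ∀ n, IsSelfAdjoint (D n) := fun n => ((hx (n + 1)).sub (hx n)).real_smul _
  have hDτ : ∀ n, (τ (D n * D n)).re ≤ (1 / 4) ^ n := by
    intro n
    rw [← hτ.l2norm_sq_of_isSelfAdjoint (hD n), hτ.l2norm_smul, mul_pow, sq_abs, ← pow_mul,
      mul_comm n, pow_mul, Real.sq_sqrt (by norm_num)]
    calc (2 : ℝ) ^ n * l2norm τ (x (n + 1) - x n) ^ 2 ≤ 2 ^ n * (1 / 8) ^ n := by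
          gcongr; exact hc n
      _ = (1 / 4) ^ n := by rw [← mul_pow]; norm_num
  obtain ⟨α, hα0, hα1, hατ, hαD, hαlim⟩ := hτ.exists_uniform_cutoff hD hDτ
  have hstep : ∀ k n, k ≤ n → ‖(x (n + 1) - x n) * (1 - α k)‖ ≤ q ^ n := by
    intro k n hkn
    have h1 := hαD k n hkn
    rw [smul_mul_assoc, norm_smul, Real.norm_eq_abs, abs_of_pos (by positivity)] at h1
    rw [hq_def, inv_pow, ← one_div, le_div_iff₀' (by positivity)]
    exact h1
  have htel : ∀ k n, k ≤ n → ∀ j, ‖(x (n + j) - x n) * (1 - α k)‖ ≤ C * (q ^ n - q ^ (n + j)) := by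
    intro k n hkn j
    induction j with
    | zero => simp
    | succ j ih =>
      have h1 := hstep k (n + j) (hkn.trans (Nat.le_add_right _ _))
      have e1 : (x (n + (j + 1)) - x n) * (1 - α k) =
          (x (n + j + 1) - x (n + j)) * (1 - α k) + (x (n + j) - x n) * (1 - α k) := by
        rw [← add_mul, sub_add_sub_cancel, add_assoc]
      have e2 : C * (q ^ n - q ^ (n + (j + 1))) =
          q ^ (n + j) * (C * (1 - q)) + C * (q ^ n - q ^ (n + j)) := by
        rw [← add_assoc, pow_succ]; ring
      rw [e1, e2, hCq, mul_one]
      exact (norm_add_le _ _).trans (add_le_add h1 ih)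
  have htel' : ∀ k n, k ≤ n → ∀ j, ‖(x (n + j) - x n) * (1 - α k)‖ ≤ C * q ^ n := by
    intro k n hkn j
    refine (htel k n hkn j).trans ?_
    have : 0 < q ^ (n + j) := by positivity
    exact mul_le_mul_of_nonneg_left (by linarith) hC0.le
  -- For differences `z` of the sequence, the first term is small in norm by the cutoff; the second
  -- is small because `z` is bounded and `α k ξ → 0`. The same splitting with `k = n` gives the L²
  -- estimate `hbound`.
  have hsplit : ∀ (z : N) k (ξ : K), (z : K →L[ℂ] K) ξ =
      ((z * (1 - α k) : N) : K →L[ℂ] K) ξ + (z : K →L[ℂ] K) ((α k : K →L[ℂ] K) ξ) := by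
    intro z k ξ
    have e : ((z * (1 - α k) : N) : K →L[ℂ] K) ξ =
      (z : K →L[ℂ] K) (ξ - (α k : K →L[ℂ] K) ξ) := rfl
    rw [e, map_sub, sub_add_cancel]
  have hqlim : Tendsto (fun n : ℕ => q ^ n) atTop (𝓝 0) :=
    tendsto_pow_atTop_nhds_zero_of_lt_one hq0.le hq1
  have hdiff : ∀ m n, ‖x m - x n‖ ≤ 2 * R := fun m n =>
    (norm_sub_le _ _).trans (by linarith [hR m, hR n])
  have hcs : ∀ ξ : K, CauchySeq fun n => (x n : K →L[ℂ] K) ξ := by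
    intro ξ
    rw [Metric.cauchySeq_iff']
    intro ε hε
    have h1 : Tendsto (fun k => C * q ^ k * ‖ξ‖ + 2 * R * ‖(α k : K →L[ℂ] K) ξ‖) atTop
        (𝓝 (C * 0 * ‖ξ‖ + 2 * R * ‖(0 : K)‖)) :=
      ((hqlim.const_mul C).mul_const _).add ((hαlim ξ).norm.const_mul _)
    rw [norm_zero, mul_zero, zero_mul, mul_zero, add_zero] at h1
    obtain ⟨k, hk⟩ := (h1.eventually (gt_mem_nhds hε)).exists
    refine ⟨k, fun n hn => lt_of_le_of_lt ?_ hk⟩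
    obtain ⟨j, rfl⟩ := Nat.exists_eq_add_of_le hn
    rw [dist_eq_norm]
    have e : (x (k + j) : K →L[ℂ] K) ξ - (x k : K →L[ℂ] K) ξ =
      ((x (k + j) - x k : N) : K →L[ℂ] K) ξ := rfl
    rw [e, hsplit _ k]
    refine (norm_add_le _ _).trans (add_le_add ?_ ?_)
    · exact ContinuousLinearMap.le_of_opNorm_le _ (htel' k k le_rfl j) ξ
    · exact ContinuousLinearMap.le_of_opNorm_le _ (hdiff _ _) _
  obtain ⟨y, hy⟩ := exists_strong_limit hcs
  have hyR : ‖y‖ ≤ R := norm_le_of_strong_limit hR0 hy (Eventually.of_forall hR)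
  refine ⟨y, strong_limit_isSelfAdjoint hy hx, hyR, ?_⟩
  have hylim : ∀ n, ‖(y - x n) * (1 - α n)‖ ≤ C * q ^ n := by
    intro n
    refine norm_le_of_strong_limit (x := fun j => (x (n + j) - x n) * (1 - α n)) (by positivity)
      (fun ξ => ?_) (Eventually.of_forall fun j => htel' n n le_rfl j)
    have h1 := (hy (((1 - α n : N) : K →L[ℂ] K) ξ)).comp (tendsto_add_atTop_nat n)
    refine (h1.sub_const ((x n : K →L[ℂ] K) (((1 - α n : N) : K →L[ℂ] K) ξ))).congr fun j => ?_
    simp only [Function.comp_apply, add_comm j n]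
    rfl
  have hαl2 : ∀ n, l2norm τ (α n) ≤ √2 * (1 / 2) ^ n := by
    intro n
    refine le_of_sq_le_sq ?_ (by positivity)
    have h1 : α n ^ 2 ≤ α n ^ 1 := CStarAlgebra.pow_antitone (hα0 n) (hα1 n) one_le_two
    rw [pow_one, sq] at h1
    rw [hτ.l2norm_sq_of_isSelfAdjoint (hα0 n).isSelfAdjoint]
    refine ((hτ.re_mono h1).trans (hατ n)).trans_eq ?_
    rw [mul_pow, Real.sq_sqrt (by norm_num), ← pow_mul, mul_comm n, pow_mul]
    norm_num
  have hbound : ∀ n, l2norm τ (x n - y) ≤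
      C * q ^ n * l2norm τ 1 + 2 * R * (√2 * (1 / 2) ^ n) := by
    intro n
    have e : y - x n = (y - x n) * (1 - α n) + (y - x n) * α n := by noncomm_ring
    rw [hτ.l2norm_sub_comm, e]
    refine (hτ.l2norm_add_le _ _).trans (add_le_add ?_ ?_)
    · exact (hτ.l2norm_le _).trans
        (mul_le_mul_of_nonneg_right (hylim n) (l2norm_nonneg _ _))
    · refine (hτ.l2norm_mul_le _ _).trans (mul_le_mul ?_ (hαl2 n) (l2norm_nonneg _ _) (by positivity))
      exact (norm_sub_le _ _).trans (by linarith [hR n])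
  have hlim : Tendsto (fun n : ℕ => C * q ^ n * l2norm τ 1 + 2 * R * (√2 * (1 / 2) ^ n)) atTop
      (𝓝 (C * 0 * l2norm τ 1 + 2 * R * (√2 * 0))) :=
    ((hqlim.const_mul C).mul_const _).add
      (((tendsto_pow_atTop_nhds_zero_of_lt_one (by norm_num) (by norm_num)).const_mul _).const_mul _)
  simp only [mul_zero, zero_mul, add_zero] at hlim
  exact squeeze_zero (fun n => l2norm_nonneg _ _) hbound hlim

end IsFaithfulNormalTrace

end Completeness

/-! ### Explicit geodesics -/

section Geodesics

variable {A : Type*} [CStarAlgebra A] [PartialOrder A] [StarOrderedRing A]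

/-- The curve `t ↦ e^h e^{tx} e^h` is a geodesic. -/
theorem isGeodesic_exp {h x : A} (hh : IsSelfAdjoint h) (hx : IsSelfAdjoint x) :
    IsGeodesic fun t : ℝ => exp h * exp (t • x) * exp h := by
  have hd : ∀ t : ℝ, HasDerivAt (fun t : ℝ => exp h * exp (t • x) * exp h)
      (exp h * (exp (t • x) * x) * exp h) t := fun t =>
    ((hasDerivAt_exp_smul_const (𝕂 := ℝ) x t).const_mul _).mul_const _
  have hd' : deriv (fun t : ℝ => exp h * exp (t • x) * exp h) =
      fun t => exp h * (exp (t • x) * x) * exp h := funext fun t => (hd t).deriv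
  have hdd : ∀ t : ℝ, HasDerivAt (fun t : ℝ => exp h * (exp (t • x) * x) * exp h)
      (exp h * (exp (t • x) * x * x) * exp h) t := fun t =>
    (((hasDerivAt_exp_smul_const (𝕂 := ℝ) x t).mul_const x).const_mul _).mul_const _
  have hpos : ∀ t : ℝ, IsStrictlyPositive (exp h * exp (t • x) * exp h) := fun t =>
    isStrictlyPositive_exp_conj hh (isStrictlyPositive_exp (hx.real_smul t))
  refine ⟨fun t => mem_posInv_iff.2 (hpos t), ?_, fun t => ?_⟩
  · have h1 : ContDiff ℝ ∞ (exp : A → A) :=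
      contDiff_iff_contDiffAt.2 fun y => (exp_analytic (𝕂 := ℝ) y).contDiffAt
    have h2 : ContDiff ℝ ∞ fun t : ℝ => t • x := contDiff_id.smul contDiff_const
    exact (contDiff_const.mul (h1.comp h2)).mul contDiff_const
  · rw [hd', (hdd t).deriv]
    have hinv : Ring.inverse (exp h * exp (t • x) * exp h) =
        exp (-h) * exp (-(t • x)) * exp (-h) := by
      refine Ring.inverse_unit (M₀ := A) ⟨exp h * exp (t • x) * exp h,
        exp (-h) * exp (-(t • x)) * exp (-h), ?_, ?_⟩
      · calc _ = exp h * (exp (t • x) * (exp h * exp (-h)) * exp (-(t • x))) * exp (-h) := by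
              simp only [mul_assoc]
          _ = 1 := by rw [exp_mul_exp_neg, mul_one, exp_mul_exp_neg, mul_one, exp_mul_exp_neg]
      · calc _ = exp (-h) * (exp (-(t • x)) * (exp (-h) * exp h) * exp (t • x)) * exp h := by
              simp only [mul_assoc]
          _ = 1 := by rw [exp_neg_mul_exp, mul_one, exp_neg_mul_exp, mul_one, exp_neg_mul_exp]
    rw [hinv]
    calc exp h * (exp (t • x) * x * x) * exp h
        = exp h * (exp (t • x) * x) * (exp h * exp (-h)) * (exp (-(t • x)) * (exp (-h) * exp h) *
          exp (t • x)) * x * exp h := by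
          rw [exp_mul_exp_neg, exp_neg_mul_exp, mul_one, mul_one, exp_neg_mul_exp, mul_one]
          simp only [mul_assoc]
      _ = _ := by simp only [mul_assoc]

end Geodesics

/-! ### Analyticity of the logarithm along geodesics -/

section LogSeries

open Filter Topology

variable {A : Type*} [CStarAlgebra A]

/-- The Taylor sums of `-log(1 - t)` converge uniformly on `[-‖w‖, ‖w‖]`, which contains the
spectrum of `w`, and the functional calculus is continuous for uniform convergence. -/
theorem tendsto_log_series {w : A} (hw : IsSelfAdjoint w) (h1 : ‖w‖ < 1) :
    Tendsto (fun n : ℕ => ∑ i ∈ Finset.range n, ((i : ℝ) + 1)⁻¹ • w ^ (i + 1)) atTop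
      (𝓝 (-CFC.log (1 - w))) := by
  have hspec : ∀ t ∈ spectrum ℝ w, |t| ≤ ‖w‖ := fun t ht => abs_le_norm_of_mem_spectrum ht
  have hcont : ContinuousOn (fun t : ℝ => Real.log (1 - t)) (spectrum ℝ w) := by
    refine ContinuousOn.log (by fun_prop) fun t ht => ?_
    have := (abs_le.1 (hspec t ht)).2
    linarith
  have hF : ∀ n : ℕ, cfc (fun t : ℝ => ∑ i ∈ Finset.range n, ((i : ℝ) + 1)⁻¹ * t ^ (i + 1)) w =
      ∑ i ∈ Finset.range n, ((i : ℝ) + 1)⁻¹ • w ^ (i + 1) := by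
    intro n
    rw [← Finset.sum_fn, cfc_sum (R := ℝ) (fun (i : ℕ) (t : ℝ) => ((i : ℝ) + 1)⁻¹ * t ^ (i + 1)) w
      _ (fun i _ => by fun_prop)]
    refine Finset.sum_congr rfl fun i _ => ?_
    rw [cfc_const_mul (R := ℝ) _ (fun t => t ^ (i + 1)) w, cfc_pow_id (R := ℝ) w]
  have hlog : cfc (fun t : ℝ => -Real.log (1 - t)) w = -CFC.log (1 - w) := by
    have e : (1 : A) - w = cfc (fun t : ℝ => 1 - t) w := by
      rw [cfc_sub (R := ℝ) (a := w) (fun _ => 1) (fun t => t), cfc_id' ℝ w, cfc_const_one ℝ w]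
    have hlogc : ContinuousOn Real.log ((fun t : ℝ => 1 - t) '' spectrum ℝ w) := by
      refine ContinuousOn.log continuousOn_id ?_
      rintro _ ⟨t, ht, rfl⟩
      have := (abs_le.1 (hspec t ht)).2
      simp only
      linarith
    rw [cfc_neg (R := ℝ) (fun t => Real.log (1 - t)) w, CFC.log, e, ← cfc_comp' Real.log _ w hlogc]
  rw [← hlog]
  simp_rw [← hF]
  refine tendsto_cfc_fun ?_ (Eventually.of_forall fun n => by fun_prop)
  rw [Metric.tendstoUniformlyOn_iff]
  intro ε hε
  have hlim : Tendsto (fun n : ℕ => ‖w‖ ^ (n + 1) / (1 - ‖w‖)) atTop (𝓝 (0 / (1 - ‖w‖))) :=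
    ((tendsto_pow_atTop_nhds_zero_of_lt_one (norm_nonneg w) h1).comp
      (tendsto_add_atTop_nat 1)).div_const _
  rw [zero_div] at hlim
  filter_upwards [hlim.eventually (gt_mem_nhds hε)] with n hn t ht
  have h2 := hspec t ht
  have h3 := Real.abs_log_sub_add_sum_range_le (h2.trans_lt h1) n
  rw [dist_comm, Real.dist_eq, sub_neg_eq_add]
  refine lt_of_le_of_lt ?_ hn
  have e : ∑ i ∈ Finset.range n, ((i : ℝ) + 1)⁻¹ * t ^ (i + 1) =
      ∑ i ∈ Finset.range n, t ^ (i + 1) / ((i : ℝ) + 1) :=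
    Finset.sum_congr rfl fun i _ => by rw [div_eq_inv_mul]
  rw [e]
  refine h3.trans ?_
  have : 0 < 1 - ‖w‖ := by linarith
  have : 1 - ‖w‖ ≤ 1 - |t| := by linarith
  gcongr

variable [PartialOrder A] [StarOrderedRing A]

theorem algebraMap_exp_neg_norm_le_exp {s : A} (hs : IsSelfAdjoint s) :
    algebraMap ℝ A (Real.exp (-‖s‖)) ≤ exp s := by
  rw [← CFC.real_exp_eq_normedSpace_exp (a := s) hs, algebraMap_le_cfc_iff Real.exp _ s]
  intro t ht
  exact Real.exp_le_exp.2 (abs_le.1 (abs_le_norm_of_mem_spectrum ht)).1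

/-- Real analyticity of `t ↦ φ(log γ(t))` along a geodesic `γ`. -/
theorem analyticAt_log_geodesic (φ : A →L[ℂ] ℂ) {h x : A} (hh : IsSelfAdjoint h)
    (hx : IsSelfAdjoint x) (t₀ : ℝ) :
    AnalyticAt ℝ (fun t : ℝ => φ (CFC.log (exp h * exp (t • x) * exp h))) t₀ := by
  have hpos : ∀ t : ℝ, IsStrictlyPositive (exp h * exp (t • x) * exp h) := fun t =>
    isStrictlyPositive_exp_conj hh (isStrictlyPositive_exp (hx.real_smul t))
  set s := CFC.log (exp h * exp (t₀ • x) * exp h) with hs_def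
  have hs : IsSelfAdjoint s := IsSelfAdjoint.log
  have hes : exp s = exp h * exp (t₀ • x) * exp h := CFC.exp_log _ (hpos t₀)
  -- Scaling by `k` gives `k² ≤ k e^s ≤ 1`, so `‖W t₀‖ ≤ 1 - k² < 1` and near `t₀` the logarithm is
  -- the constant `-log k` minus a power series in `W`. As `W` is entire in the complex parameter,
  -- the series is holomorphic where `‖W z‖ < ρ`.
  set k : ℝ := Real.exp (-‖s‖) with hk_def
  have hk : 0 < k := Real.exp_pos _
  let W : ℂ → A := fun z => 1 - k • (exp h * exp (z • x) * exp h)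
  have hWd : Differentiable ℂ W := fun z =>
    ((((hasDerivAt_exp_smul_const (𝕂 := ℂ) x z).const_mul _).mul_const _).differentiableAt.const_smul
      k).const_sub 1
  have hWreal : ∀ t : ℝ, W t = 1 - k • (exp h * exp (t • x) * exp h) := fun t => by
    simp only [W, Complex.coe_smul]
  have hWsa : ∀ t : ℝ, IsSelfAdjoint (W t) := fun t => by
    rw [hWreal]
    exact (IsSelfAdjoint.one A).sub ((hpos t).nonneg.isSelfAdjoint.real_smul k)
  have hW0 : ‖W t₀‖ < 1 := by
    have h1 : exp s ≤ algebraMap ℝ A (Real.exp ‖s‖) :=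
      (le_algebraMap_iff_exp_le hs _).1 hs.le_algebraMap_norm_self
    have h2 : k • exp s ≤ 1 := by
      have := smul_le_smul_of_nonneg_left h1 hk.le
      rwa [Algebra.algebraMap_eq_smul_one, smul_smul, hk_def, ← Real.exp_add, neg_add_cancel,
        Real.exp_zero, one_smul] at this
    have h3 : algebraMap ℝ A (k * k) ≤ k • exp s := by
      have := smul_le_smul_of_nonneg_left (algebraMap_exp_neg_norm_le_exp hs) hk.le
      rwa [← hk_def, Algebra.algebraMap_eq_smul_one, smul_smul,
        ← Algebra.algebraMap_eq_smul_one] at this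
    have hk1 : k ≤ 1 := Real.exp_le_one_iff.2 (by simp)
    have h4 : ‖W t₀‖ ≤ 1 - k * k := by
      rw [hWreal, ← hes]
      rw [CStarAlgebra.norm_le_iff_le_algebraMap _ (by nlinarith) (sub_nonneg.2 h2), map_sub,
        map_one]
      exact sub_le_sub_left h3 1
    nlinarith
  obtain ⟨ρ, hρ1, hρ2⟩ := exists_between hW0
  have hρ0 : 0 ≤ ρ := (norm_nonneg _).trans hρ1.le
  let U : Set ℂ := {z | ‖W z‖ < ρ}
  have hU : IsOpen U := isOpen_lt hWd.continuous.norm continuous_const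
  let F : ℕ → ℂ → A := fun n z => ((n : ℝ) + 1)⁻¹ • W z ^ (n + 1)
  have hFd : ∀ n, DifferentiableOn ℂ (F n) U := fun n =>
    ((hWd.pow (n + 1)).const_smul _).differentiableOn
  have hFle : ∀ n z, z ∈ U → ‖F n z‖ ≤ ρ ^ (n + 1) := by
    intro n z hz
    have hz' : ‖W z‖ < ρ := hz
    rw [norm_smul, Real.norm_eq_abs, abs_of_pos (by positivity)]
    have h1 : ((n : ℝ) + 1)⁻¹ ≤ 1 := inv_le_one_of_one_le₀ (by linarith [n.cast_nonneg (α := ℝ)])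
    calc _ ≤ 1 * ‖W z‖ ^ (n + 1) :=
          mul_le_mul h1 (norm_pow_le' _ n.succ_pos) (norm_nonneg _) zero_le_one
      _ ≤ ρ ^ (n + 1) := by rw [one_mul]; gcongr
  have hsum : Summable fun n : ℕ => ρ ^ (n + 1) :=
    (summable_nat_add_iff 1).2 (summable_geometric_of_lt_one hρ0 hρ2)
  have hL : AnalyticAt ℂ (fun z => ∑' n, F n z) (t₀ : ℂ) :=
    (Complex.differentiableOn_tsum_of_summable_norm hsum hFd hU hFle).analyticAt (hU.mem_nhds hρ1)
  have hφL : AnalyticAt ℝ (fun z => φ (∑' n, F n z)) (t₀ : ℂ) :=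
    ((φ.analyticAt _).comp hL).restrictScalars
  have hcomp : AnalyticAt ℝ (fun t : ℝ => φ (∑' n, F n (t : ℂ))) t₀ :=
    AnalyticAt.fun_comp (f := fun t : ℝ => (t : ℂ)) hφL (Complex.ofRealCLM.analyticAt t₀)
  have hlogeq : ∀ t : ℝ, (t : ℂ) ∈ U → CFC.log (exp h * exp (t • x) * exp h) =
      algebraMap ℝ A (-Real.log k) - ∑' n, F n (t : ℂ) := by
    intro t ht
    have h1 : ‖W t‖ < 1 := lt_trans ht hρ2
    have h2 : Summable fun n => F n (t : ℂ) :=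
      Summable.of_norm_bounded hsum fun n => hFle n _ ht
    have h3 := tendsto_nhds_unique h2.hasSum.tendsto_sum_nat (tendsto_log_series (hWsa t) h1)
    rw [h3, hWreal, sub_sub_cancel, CFC.log_smul' _ hk (hpos t), map_neg]
    abel
  have hev : ∀ᶠ t : ℝ in 𝓝 t₀, (t : ℂ) ∈ U :=
    Complex.continuous_ofReal.continuousAt.eventually (hU.mem_nhds hρ1)
  refine (analyticAt_const.sub hcomp :
    AnalyticAt ℝ (fun t : ℝ => φ (algebraMap ℝ A (-Real.log k)) - φ (∑' n, F n (t : ℂ))) t₀).congr ?_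
  filter_upwards [hev] with t ht
  rw [hlogeq t ht, map_sub]
  rfl

/-- If `φ ∘ log` vanishes along a geodesic on `[0,1]`, it vanishes along the whole geodesic. -/
theorem apply_log_geodesic_eq_zero (φ : A →L[ℂ] ℂ) {h x : A} (hh : IsSelfAdjoint h)
    (hx : IsSelfAdjoint x)
    (h0 : ∀ t ∈ Set.Icc (0 : ℝ) 1, φ (CFC.log (exp h * exp (t • x) * exp h)) = 0) (t : ℝ) :
    φ (CFC.log (exp h * exp (t • x) * exp h)) = 0 := by
  have h1 : AnalyticOnNhd ℝ (fun t : ℝ => φ (CFC.log (exp h * exp (t • x) * exp h))) Set.univ :=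
    fun t _ => analyticAt_log_geodesic φ hh hx t
  have h2 : (fun t : ℝ => φ (CFC.log (exp h * exp (t • x) * exp h))) =ᶠ[𝓝 (1 / 2)]
      fun _ => (0 : ℂ) := by
    filter_upwards [Icc_mem_nhds (show (0 : ℝ) < 1 / 2 by norm_num)
      (show (1 / 2 : ℝ) < 1 by norm_num)] with t ht
    exact h0 t ht
  exact congrFun (h1.eq_of_eventuallyEq analyticOnNhd_const h2) t

end LogSeries

/-! ### Order bounds for `e^a e^b e^a` and geodesic midpoints -/

section ExpSandwich

variable {A : Type*} [CStarAlgebra A]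

theorem exp_neg_of_exp_eq {x a b : A} (h : exp x = exp a * exp b * exp a) :
    exp (-x) = exp (-a) * exp (-b) * exp (-a) := by
  have h1 : exp a * exp b * exp a * (exp (-a) * exp (-b) * exp (-a)) = 1 := by
    calc _ = exp a * (exp b * (exp a * exp (-a)) * exp (-b)) * exp (-a) := by
          simp only [mul_assoc]
      _ = 1 := by rw [exp_mul_exp_neg, mul_one, exp_mul_exp_neg, mul_one, exp_mul_exp_neg]
  calc exp (-x) = exp (-x) * (exp x * (exp (-a) * exp (-b) * exp (-a))) := by
        rw [h, h1, mul_one]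
    _ = _ := by rw [← mul_assoc, exp_neg_mul_exp, one_mul]

theorem exp_sandwich_symm {x a y : A} (h : y = exp (-a) * x * exp (-a)) :
    x = exp a * y * exp a := by
  calc x = exp a * exp (-a) * x * (exp (-a) * exp a) := by
        rw [exp_mul_exp_neg, exp_neg_mul_exp, one_mul, mul_one]
    _ = exp a * (exp (-a) * x * exp (-a)) * exp a := by simp only [mul_assoc]
    _ = _ := by rw [h]

theorem exp_algebraMap_add (c : ℝ) (x : A) :
    exp (algebraMap ℝ A c + x) = Real.exp c • exp x := by
  let _ : NormedAlgebra ℚ A := NormedAlgebra.restrictScalars ℚ ℝ A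
  rw [exp_add_of_comm (Algebra.commutes c x), ← algebraMap_exp_comm, ← Real.exp_eq_exp_ℝ,
    Algebra.smul_def]

theorem isSelfAdjoint_algebraMap_real (c : ℝ) : IsSelfAdjoint (algebraMap ℝ A c) :=
  IsSelfAdjoint.algebraMap A (IsSelfAdjoint.all c)

variable [PartialOrder A] [StarOrderedRing A]

theorem exp_sandwich_le {a x y : A} (ha : IsSelfAdjoint a) (h : x ≤ y) :
    exp a * x * exp a ≤ exp a * y * exp a := by
  simpa [ha.exp.star_eq] using star_left_conjugate_le_conjugate h (exp a)

/-- An upper bound on `s` from one on `ρ`, where `e^s = e^a e^ρ e^a`. -/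
theorem le_algebraMap_add_of_exp_eq {s ρ a : A} (hs : IsSelfAdjoint s) (hρ : IsSelfAdjoint ρ)
    (ha : IsSelfAdjoint a) {c : ℝ} (hc : ρ ≤ algebraMap ℝ A c)
    (h : exp s = exp a * exp ρ * exp a) : s ≤ algebraMap ℝ A c + (2 : ℝ) • a := by
  have h1 := exp_sandwich_le ha ((le_algebraMap_iff_exp_le hρ c).1 hc)
  have h2 : exp a * algebraMap ℝ A (Real.exp c) * exp a =
      exp (algebraMap ℝ A c + (2 : ℝ) • a) := by
    rw [exp_algebraMap_add, ← exp_mul_exp_self, Algebra.algebraMap_eq_smul_one, mul_smul_comm,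
      mul_one, smul_mul_assoc]
  rw [← h, h2] at h1
  have h3 := CFC.log_le_log h1 (isStrictlyPositive_exp hs)
  rwa [CFC.log_exp s, CFC.log_exp _ ((isSelfAdjoint_algebraMap_real c).add (ha.real_smul 2))] at h3

/-- Order intervals are stable under geodesic midpoints. -/
theorem midpoint_le {h h' k l : A} (hh : IsSelfAdjoint h) (hh' : IsSelfAdjoint h')
    (hk : IsSelfAdjoint k) (hl : IsSelfAdjoint l)
    (e1 : exp ((2 : ℝ) • k) = exp (-h) * exp ((2 : ℝ) • h') * exp (-h))
    (e2 : exp ((2 : ℝ) • l) = exp h * exp k * exp h) {R : ℝ} (hR : h ≤ algebraMap ℝ A R)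
    (hR' : h' ≤ algebraMap ℝ A R) : l ≤ algebraMap ℝ A R := by
  -- The chain is `e^{2k} ≤ (e^R e^{-h})²`, hence `e^k ≤ e^R e^{-h}` since the square root is
  -- operator monotone, hence `e^{2l} ≤ e^R e^h ≤ e^{2R}`.
  have a1 : exp ((2 : ℝ) • h') ≤ algebraMap ℝ A (Real.exp (2 * R)) :=
    (le_algebraMap_iff_exp_le (hh'.real_smul 2) _).1
      ((smul_le_algebraMap_smul_iff two_pos R).2 hR')
  have a2 := exp_sandwich_le hh.neg a1
  rw [← e1] at a2
  have a3 : exp (-h) * algebraMap ℝ A (Real.exp (2 * R)) * exp (-h) =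
      (Real.exp R • exp (-h)) * (Real.exp R • exp (-h)) := by
    rw [Algebra.algebraMap_eq_smul_one, mul_smul_comm, mul_one, smul_mul_assoc, smul_mul_smul_comm,
      ← Real.exp_add, two_mul]
  rw [a3, ← exp_mul_exp_self] at a2
  have a4 := CFC.sqrt_le_sqrt _ _ a2
  rw [CFC.sqrt_mul_self _ hk.exp_nonneg,
    CFC.sqrt_mul_self _ (smul_nonneg (Real.exp_nonneg R) hh.neg.exp_nonneg)] at a4
  have a5 := exp_sandwich_le hh a4
  rw [← e2] at a5
  have a6 : exp h * (Real.exp R • exp (-h)) * exp h = Real.exp R • exp h := by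
    rw [mul_smul_comm, exp_mul_exp_neg, smul_mul_assoc, one_mul]
  rw [a6] at a5
  have a7 : Real.exp R • exp h ≤ algebraMap ℝ A (Real.exp (2 * R)) := by
    have := smul_le_smul_of_nonneg_left ((le_algebraMap_iff_exp_le hh R).1 hR) (Real.exp_nonneg R)
    rwa [Algebra.algebraMap_eq_smul_one, smul_smul, ← Real.exp_add, ← two_mul,
      ← Algebra.algebraMap_eq_smul_one] at this
  exact (smul_le_algebraMap_smul_iff two_pos R).1
    ((le_algebraMap_iff_exp_le (hl.real_smul 2) _).2 (a5.trans a7))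

/-- Inversion negates all four elements and preserves both relations, so the one-sided bound applies
twice. This keeps midpoints of a minimizing sequence admissible. -/
theorem norm_midpoint_le {h h' k l : A} (hh : IsSelfAdjoint h) (hh' : IsSelfAdjoint h')
    (hk : IsSelfAdjoint k) (hl : IsSelfAdjoint l)
    (e1 : exp ((2 : ℝ) • k) = exp (-h) * exp ((2 : ℝ) • h') * exp (-h))
    (e2 : exp ((2 : ℝ) • l) = exp h * exp k * exp h) {R : ℝ} (hR : ‖h‖ ≤ R)
    (hR' : ‖h'‖ ≤ R) : ‖l‖ ≤ R := by
  have hR0 : 0 ≤ R := (norm_nonneg _).trans hR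
  rw [norm_le_iff_le_and_neg_le hh hR0] at hR
  rw [norm_le_iff_le_and_neg_le hh' hR0] at hR'
  rw [norm_le_iff_le_and_neg_le hl hR0]
  refine ⟨midpoint_le hh hh' hk hl e1 e2 hR.1 hR'.1, ?_⟩
  refine midpoint_le hh.neg hh'.neg hk.neg hl.neg ?_ ?_ hR.2 hR'.2
  · rw [smul_neg, smul_neg]; exact exp_neg_of_exp_eq e1
  · rw [smul_neg]; exact exp_neg_of_exp_eq e2

/-- Moving from `e^{2h}` in a direction `x` close to `-2h` does not leave an order interval. -/
theorem le_of_exp_eq_sandwich {h a x l : A} (hh : IsSelfAdjoint h) (ha : IsSelfAdjoint a)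
    (hl : IsSelfAdjoint l) (hx : x = a - (2 : ℝ) • h) {R ε : ℝ} (hR : h ≤ algebraMap ℝ A R)
    (haR : ‖a‖ ≤ 2 * R - 1) (hε : 0 < ε) (hε1 : ε ≤ 1) (hεx : ε * ‖x‖ ≤ 1)
    (hεx2 : ε * ‖x‖ ^ 2 ≤ 1) (e : exp ((2 : ℝ) • l) = exp h * exp (ε • x) * exp h) :
    l ≤ algebraMap ℝ A R := by
  have hxs : IsSelfAdjoint x := by rw [hx]; exact ha.sub (hh.real_smul 2)
  have hn : ‖ε • x‖ = ε * ‖x‖ := by rw [norm_smul, Real.norm_eq_abs, abs_of_pos hε]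
  have b1 := exp_le_one_add_add_sq (hxs.real_smul ε) (hn.le.trans hεx)
  -- `w` commutes with `h` and dominates `εx + ‖εx‖²`: the slack `-1` in `‖a‖ ≤ 2R - 1` absorbs the
  -- quadratic error, which is at most `ε`. Then `e^h e^w e^h = e^{2εR + 2(1-ε)h}`, whose exponent
  -- is a convex combination of `2R` and `2h`.
  set w := algebraMap ℝ A (2 * ε * R) + (-(2 * ε)) • h with hw_def
  have hw : IsSelfAdjoint w := (isSelfAdjoint_algebraMap_real _).add (hh.real_smul _)
  have b2 : ε • x + algebraMap ℝ A (‖ε • x‖ ^ 2) ≤ w := by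
    have c1 : ε • a ≤ algebraMap ℝ A (ε * (2 * R - 1)) := by
      rw [smul_le_algebraMap_smul_iff hε]
      exact ha.le_algebraMap_norm_self.trans (algebraMap_mono A haR)
    have c2 : algebraMap ℝ A (‖ε • x‖ ^ 2) ≤ algebraMap ℝ A ε := by
      refine algebraMap_mono A ?_
      rw [hn]; nlinarith
    have c3 : w = algebraMap ℝ A (ε * (2 * R - 1)) + algebraMap ℝ A ε - ε • (2 : ℝ) • h := by
      rw [hw_def, ← map_add, smul_smul, neg_smul, mul_comm ε 2, ← sub_eq_add_neg]
      ring_nf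
    have c4 : ε • x + algebraMap ℝ A (‖ε • x‖ ^ 2) =
        ε • a + algebraMap ℝ A (‖ε • x‖ ^ 2) - ε • (2 : ℝ) • h := by
      rw [hx, smul_sub]; abel
    rw [c3, c4]
    exact sub_le_sub_right (add_le_add c1 c2) _
  have b3 : exp (ε • x) ≤ exp w := by
    refine b1.trans (le_trans ?_ (one_add_le_exp hw))
    rw [add_assoc]
    exact add_le_add_right b2 1
  have b4 := exp_sandwich_le hh b3
  rw [← e] at b4
  have b5 : exp h * exp w * exp h = exp (algebraMap ℝ A (2 * ε * R) + (2 * (1 - ε)) • h) := by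
    rw [hw_def, exp_algebraMap_add, exp_algebraMap_add, mul_smul_comm, smul_mul_assoc]
    congr 1
    nth_rewrite 1 [← one_smul ℝ h]
    nth_rewrite 3 [← one_smul ℝ h]
    rw [exp_smul_mul_exp_smul, exp_smul_mul_exp_smul]
    ring_nf
  have b6 : algebraMap ℝ A (2 * ε * R) + (2 * (1 - ε)) • h ≤ algebraMap ℝ A (2 * R) := by
    have c1 : (2 * (1 - ε)) • h ≤ algebraMap ℝ A (2 * (1 - ε) * R) := by
      have := smul_le_smul_of_nonneg_left hR (show 0 ≤ 2 * (1 - ε) by linarith)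
      rwa [Algebra.algebraMap_eq_smul_one, smul_smul, ← Algebra.algebraMap_eq_smul_one] at this
    calc _ ≤ algebraMap ℝ A (2 * ε * R) + algebraMap ℝ A (2 * (1 - ε) * R) :=
          add_le_add_right c1 _
      _ = _ := by rw [← map_add]; ring_nf
  have b7 := (le_algebraMap_iff_exp_le
    ((isSelfAdjoint_algebraMap_real _).add (hh.real_smul _)) _).1 b6
  rw [b5] at b4
  exact (smul_le_algebraMap_smul_iff two_pos R).1
    ((le_algebraMap_iff_exp_le (hl.real_smul 2) _).2 (b4.trans b7))

theorem norm_le_of_exp_eq_sandwich {h a x l : A} (hh : IsSelfAdjoint h) (ha : IsSelfAdjoint a)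
    (hl : IsSelfAdjoint l) (hx : x = a - (2 : ℝ) • h) {R ε : ℝ} (hR : ‖h‖ ≤ R)
    (haR : ‖a‖ ≤ 2 * R - 1) (hε : 0 < ε) (hεx : ε * (1 + ‖x‖ + ‖x‖ ^ 2) ≤ 1)
    (e : exp ((2 : ℝ) • l) = exp h * exp (ε • x) * exp h) : ‖l‖ ≤ R := by
  have hR0 : 0 ≤ R := (norm_nonneg _).trans hR
  have p1 : 0 ≤ ε * ‖x‖ := by positivity
  have p2 : 0 ≤ ε * ‖x‖ ^ 2 := by positivity
  rw [mul_add, mul_add, mul_one] at hεx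
  have q0 : ε ≤ 1 := by linarith
  have q1 : ε * ‖x‖ ≤ 1 := by linarith
  have q2 : ε * ‖x‖ ^ 2 ≤ 1 := by linarith
  rw [norm_le_iff_le_and_neg_le hh hR0] at hR
  rw [norm_le_iff_le_and_neg_le hl hR0]
  refine ⟨le_of_exp_eq_sandwich hh ha hl hx hR.1 haR hε q0 q1 q2 e, ?_⟩
  refine le_of_exp_eq_sandwich (x := -x) hh.neg ha.neg hl.neg ?_ hR.2 (by rwa [norm_neg]) hε q0
    (by rwa [norm_neg]) (by rwa [norm_neg]) ?_
  · rw [hx, smul_neg]; abel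
  · rw [smul_neg, smul_neg]; exact exp_neg_of_exp_eq e

end ExpSandwich

/-! ### The distance to a point: invariance, semi-parallelogram law, Lipschitz bound -/

section DistanceFunction

variable {A : Type*} [CStarAlgebra A] [PartialOrder A] [StarOrderedRing A] {τ : A →ₗ[ℂ] ℂ}

/-- The initial velocity, transported to `1`, of the geodesic from `e^{2h}` to `e^ρ`. -/
noncomputable def relLog (ρ h : A) : A := CFC.log (exp (-h) * exp ρ * exp (-h))

omit [PartialOrder A] [StarOrderedRing A] in
theorem isSelfAdjoint_relLog (ρ h : A) : IsSelfAdjoint (relLog ρ h) := IsSelfAdjoint.log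

theorem exp_relLog {ρ h : A} (hρ : IsSelfAdjoint ρ) (hh : IsSelfAdjoint h) :
    exp (relLog ρ h) = exp (-h) * exp ρ * exp (-h) :=
  CFC.exp_log _ (isStrictlyPositive_exp_conj hh.neg (isStrictlyPositive_exp hρ))

/-- Operator monotonicity of the logarithm gives `relLog ρ h ≤ ‖ρ‖ - 2h`, and the same bound for the
inverses gives the other side. The estimate is independent of `h`, so `R` can be fixed before the
minimizer is known. -/
theorem norm_relLog_add_le {ρ h : A} (hρ : IsSelfAdjoint ρ) (hh : IsSelfAdjoint h) :
    ‖relLog ρ h + (2 : ℝ) • h‖ ≤ ‖ρ‖ := by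
  have hs := isSelfAdjoint_relLog ρ h
  rw [norm_le_iff_le_and_neg_le (hs.add (hh.real_smul 2)) (norm_nonneg _)]
  have h1 := le_algebraMap_add_of_exp_eq hs hρ hh.neg hρ.le_algebraMap_norm_self
    (exp_relLog hρ hh)
  have h2 := hρ.neg.le_algebraMap_norm_self
  rw [norm_neg] at h2
  have h3 := le_algebraMap_add_of_exp_eq hs.neg hρ.neg hh.neg.neg h2
    (exp_neg_of_exp_eq (exp_relLog hρ hh))
  rw [smul_neg, ← sub_eq_add_neg, le_sub_iff_add_le] at h1
  rw [neg_neg, ← sub_le_iff_le_add, ← neg_add'] at h3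
  exact ⟨h1, h3⟩

namespace IsFaithfulNormalTrace

/-- The distance to `e^{2h}` can be computed from any `a` with `a a⋆ = e^{2h}`. -/
theorem l2norm_relLog_eq (hτ : IsFaithfulNormalTrace τ) {ρ h y a b : A} (hρ : IsSelfAdjoint ρ)
    (hh : IsSelfAdjoint h) (hy : IsSelfAdjoint y) (hab : a * b = 1) (hba : b * a = 1)
    (ha : exp ((2 : ℝ) • h) = a * star a) (hexp : exp y = b * exp ρ * star b) :
    l2norm τ (relLog ρ h) = l2norm τ y := by
  have hba' : star b * star a = 1 := by rw [← star_mul, hab, star_one]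
  have hstar : star (exp (-h) * a) = star a * exp (-h) := by rw [star_mul, hh.neg.exp.star_eq]
  -- `e^{-h} a` is unitary because `a a⋆ = e^{2h}`, and it conjugates `e^y` into `e^{relLog ρ h}`.
  have huv : exp (-h) * a * (star a * exp (-h)) = 1 := by
    calc _ = exp (-h) * (a * star a) * exp (-h) := by simp only [mul_assoc]
      _ = (exp (-h) * exp h) * (exp h * exp (-h)) := by
          rw [← ha, ← exp_mul_exp_self]; simp only [mul_assoc]
      _ = 1 := by rw [exp_neg_mul_exp, exp_mul_exp_neg, one_mul]
  have hwu : b * exp h * (exp (-h) * a) = 1 := by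
    calc _ = b * (exp h * exp (-h)) * a := by simp only [mul_assoc]
      _ = 1 := by rw [exp_mul_exp_neg, mul_one, hba]
  have hvu : star a * exp (-h) * (exp (-h) * a) = 1 := by
    rw [← left_inv_eq_right_inv hwu huv, hwu]
  refine hτ.l2norm_eq_of_exp_eq_conj hy (isSelfAdjoint_relLog ρ h) huv hvu hstar ?_
  rw [exp_relLog hρ hh, hexp]
  calc _ = exp (-h) * 1 * exp ρ * 1 * exp (-h) := by rw [mul_one, mul_one]
    _ = exp (-h) * (a * b) * exp ρ * (star b * star a) * exp (-h) := by rw [hab, hba']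
    _ = _ := by simp only [mul_assoc]

theorem l2norm_parallelogram (hτ : IsFaithfulNormalTrace τ) (x y : A) :
    l2norm τ (x + y) ^ 2 + l2norm τ (x - y) ^ 2 = 2 * (l2norm τ x ^ 2 + l2norm τ y ^ 2) := by
  simp only [hτ.l2norm_sq, star_add, star_sub, add_mul, mul_add, sub_mul, mul_sub, map_add,
    map_sub, Complex.add_re, Complex.sub_re]
  ring

/-- The semi-parallelogram law for the distance of the trace metric. -/
theorem semi_parallelogram (hτ : IsFaithfulNormalTrace τ) {ρ h h' k l : A} (hρ : IsSelfAdjoint ρ)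
    (hh : IsSelfAdjoint h) (hh' : IsSelfAdjoint h') (hk : IsSelfAdjoint k) (hl : IsSelfAdjoint l)
    (e1 : exp ((2 : ℝ) • k) = exp (-h) * exp ((2 : ℝ) • h') * exp (-h))
    (e2 : exp ((2 : ℝ) • l) = exp h * exp k * exp h) :
    2 * (l2norm τ (relLog ρ l) ^ 2 + l2norm τ k ^ 2) ≤
      l2norm τ (relLog ρ h) ^ 2 + l2norm τ (relLog ρ h') ^ 2 := by
  -- Congruence by the inverse of `e^h e^{k/2}` moves the midpoint `e^{2l}` to `1`, the ends to
  -- `e^{-k}` and `e^k`, and `e^ρ` to `e^y`. The metric increasing property bounds `‖y + k‖` and `‖y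
  -- - k‖` by the two distances; the rest is the parallelogram identity.
  set k2 := (1 / 2 : ℝ) • k with hk2_def
  have hk2 : IsSelfAdjoint k2 := hk.real_smul _
  have ek : exp k2 * exp k2 = exp k := exp_half_mul_exp_half k
  have ek' : exp (-k2) * exp (-k2) = exp (-k) := by
    rw [hk2_def, ← smul_neg, exp_half_mul_exp_half]
  set y := CFC.log (exp (-k2) * exp (relLog ρ h) * exp (-k2)) with hy_def
  have hy : IsSelfAdjoint y := IsSelfAdjoint.log
  have ey : exp y = exp (-k2) * exp (relLog ρ h) * exp (-k2) :=
    CFC.exp_log _ (isStrictlyPositive_exp_conj hk2.neg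
      (isStrictlyPositive_exp (isSelfAdjoint_relLog ρ h)))
  set y' := CFC.log (exp (-k2) * exp y * exp (-k2)) with hy'_def
  have hy' : IsSelfAdjoint y' := IsSelfAdjoint.log
  have ey' : exp y' = exp (-k2) * exp y * exp (-k2) :=
    CFC.exp_log _ (isStrictlyPositive_exp_conj hk2.neg (isStrictlyPositive_exp hy))
  have i1 : l2norm τ (y + k) ≤ l2norm τ (relLog ρ h) := by
    have := hτ.l2norm_sub_le_of_exp_eq (s := -k) hk.neg hy (isSelfAdjoint_relLog ρ h)
      (by rw [smul_neg]; exact ey)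
    rwa [sub_neg_eq_add] at this
  have i2 : l2norm τ (y - k) ≤ l2norm τ y' :=
    hτ.l2norm_sub_le_of_exp_eq hk hy hy' (exp_sandwich_symm ey')
  have i3 : l2norm τ (relLog ρ l) = l2norm τ y := by
    refine hτ.l2norm_relLog_eq (a := exp h * exp k2) (b := exp (-k2) * exp (-h)) hρ hl hy ?_ ?_ ?_ ?_
    · calc _ = exp h * (exp k2 * exp (-k2)) * exp (-h) := by simp only [mul_assoc]
        _ = 1 := by rw [exp_mul_exp_neg, mul_one, exp_mul_exp_neg]
    · calc _ = exp (-k2) * (exp (-h) * exp h) * exp k2 := by simp only [mul_assoc]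
        _ = 1 := by rw [exp_neg_mul_exp, mul_one, exp_neg_mul_exp]
    · rw [e2, star_mul, hk2.exp.star_eq, hh.exp.star_eq, ← ek]
      simp only [mul_assoc]
    · rw [ey, exp_relLog hρ hh, star_mul, hk2.neg.exp.star_eq, hh.neg.exp.star_eq]
      simp only [mul_assoc]
  have i4 : l2norm τ (relLog ρ h') = l2norm τ y' := by
    refine hτ.l2norm_relLog_eq (a := exp h * exp k) (b := exp (-k) * exp (-h)) hρ hh' hy' ?_ ?_ ?_ ?_
    · calc _ = exp h * (exp k * exp (-k)) * exp (-h) := by simp only [mul_assoc]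
        _ = 1 := by rw [exp_mul_exp_neg, mul_one, exp_mul_exp_neg]
    · calc _ = exp (-k) * (exp (-h) * exp h) * exp k := by simp only [mul_assoc]
        _ = 1 := by rw [exp_neg_mul_exp, mul_one, exp_neg_mul_exp]
    · rw [exp_sandwich_symm e1, star_mul, hk.exp.star_eq, hh.exp.star_eq, ← exp_mul_exp_self]
      simp only [mul_assoc]
    · rw [ey', ey, exp_relLog hρ hh, star_mul, hk.neg.exp.star_eq, hh.neg.exp.star_eq, ← ek']
      simp only [mul_assoc]
  have i5 := hτ.l2norm_parallelogram y k
  rw [i3, i4, ← i5]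
  gcongr <;> exact l2norm_nonneg _ _

/-- The metric increasing property for `2h`, `2h'`, `2k`, halved. It converts smallness of `k` in
the semi-parallelogram law into an L²-Cauchy estimate. -/
theorem l2norm_sub_le_of_midpoint (hτ : IsFaithfulNormalTrace τ) {h h' k : A}
    (hh : IsSelfAdjoint h) (hh' : IsSelfAdjoint h') (hk : IsSelfAdjoint k)
    (e1 : exp ((2 : ℝ) • k) = exp (-h) * exp ((2 : ℝ) • h') * exp (-h)) :
    l2norm τ (h' - h) ≤ l2norm τ k := by
  have h1 := hτ.l2norm_sub_le_of_exp_eq (hh.real_smul 2) (hh'.real_smul 2) (hk.real_smul 2) (by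
    rw [smul_smul]; norm_num; exact exp_sandwich_symm e1)
  rw [← smul_sub, hτ.l2norm_smul, hτ.l2norm_smul] at h1
  exact le_of_mul_le_mul_left h1 (by norm_num)

/-- The exponential is `L²`-Lipschitz on norm-bounded sets. -/
theorem l2norm_exp_sub_exp_le (hτ : IsFaithfulNormalTrace τ) {a b : A} (ha : IsSelfAdjoint a)
    (hb : IsSelfAdjoint b) {R : ℝ} (haR : ‖a‖ ≤ R) (hbR : ‖b‖ ≤ R) :
    l2norm τ (exp a - exp b) ≤ Real.exp R * Real.exp R * l2norm τ (a - b) := by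
  have hR : 0 ≤ R := (norm_nonneg _).trans haR
  have hbd : ∀ c : A, IsSelfAdjoint c → ‖c‖ ≤ R → ∀ u ∈ Set.Icc (0 : ℝ) 1,
      ‖exp (u • c)‖ ≤ Real.exp R := by
    intro c hc hcR u hu
    refine norm_exp_le_of_le (hc.real_smul u) ((hc.real_smul u).le_algebraMap_norm_self.trans
      (algebraMap_mono A ?_))
    rw [norm_smul, Real.norm_eq_abs, abs_of_nonneg hu.1]
    nlinarith [norm_nonneg c, hu.2]
  set z := exp a - exp b
  -- Duhamel interpolation from `e^b` to `e^a`; pairing with `z` reduces the estimate to a scalar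
  -- mean value inequality.
  let G : ℝ → A := fun u => exp (u • a) * exp ((1 - u) • b)
  let G' : ℝ → A := fun u => exp (u • a) * (a - b) * exp ((1 - u) • b)
  have hG : ∀ u, HasDerivAt (fun u => hτ.reCLM (star z * G u)) (hτ.reCLM (star z * G' u)) u := by
    intro u
    have h1 := hasDerivAt_exp_smul_const (𝕂 := ℝ) a u
    have h2 := (hasDerivAt_exp_smul_const' (𝕂 := ℝ) b (1 - u)).scomp u
      ((hasDerivAt_id u).const_sub 1)
    have h3 : HasDerivAt G (G' u) u := by
      refine (h1.mul h2).congr_deriv ?_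
      simp only [G', Function.comp_apply, neg_smul, one_smul]
      noncomm_ring
    exact hτ.reCLM.hasFDerivAt.comp_hasDerivAt u (h3.const_mul (star z))
  have hbound : ∀ u ∈ Set.Icc (0 : ℝ) 1, ‖hτ.reCLM (star z * G' u)‖ ≤
      l2norm τ z * (Real.exp R * Real.exp R * l2norm τ (a - b)) := by
    intro u hu
    have hu' : 1 - u ∈ Set.Icc (0 : ℝ) 1 := ⟨by linarith [hu.2], by linarith [hu.1]⟩
    have h1 : l2norm τ (G' u) ≤ Real.exp R * l2norm τ (a - b) * Real.exp R := by
      refine (hτ.l2norm_mul_le' _ _).trans (mul_le_mul ?_ (hbd b hb hbR _ hu') (norm_nonneg _) ?_)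
      · exact (hτ.l2norm_mul_le _ _).trans
          (mul_le_mul_of_nonneg_right (hbd a ha haR _ hu) (l2norm_nonneg _ _))
      · exact mul_nonneg (Real.exp_nonneg _) (l2norm_nonneg _ _)
    refine (hτ.abs_re_le z (G' u)).trans (mul_le_mul_of_nonneg_left ?_ (l2norm_nonneg _ _))
    linarith
  have hmv := (convex_Icc (0 : ℝ) 1).norm_image_sub_le_of_norm_hasDerivWithin_le
    (fun u _ => (hG u).hasDerivWithinAt) hbound (Set.left_mem_Icc.2 zero_le_one)
    (Set.right_mem_Icc.2 zero_le_one)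
  have hz : hτ.reCLM (star z * G 1) - hτ.reCLM (star z * G 0) = l2norm τ z ^ 2 := by
    rw [← map_sub, ← mul_sub, hτ.l2norm_sq, reCLM_apply]
    simp [G, z]
  rw [hz, sub_zero, norm_one, mul_one] at hmv
  have h1 := (le_abs_self _).trans hmv
  rcases (l2norm_nonneg τ z).eq_or_lt with h | h
  · rw [← h]
    have := l2norm_nonneg τ (a - b)
    positivity
  · rw [sq] at h1; exact le_of_mul_le_mul_left h1 h

/-- On a norm ball the factors `e^{±h}` are bounded, so the L²-Lipschitz bounds for the exponential,
the congruence and the logarithm compose. This lets the objective pass to L²-limits that need not be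
norm limits. -/
theorem exists_l2norm_relLog_sub_le (hτ : IsFaithfulNormalTrace τ) {ρ : A} (hρ : IsSelfAdjoint ρ)
    (R : ℝ) : ∃ C : ℝ, ∀ h h' : A, IsSelfAdjoint h → IsSelfAdjoint h' → ‖h‖ ≤ R → ‖h'‖ ≤ R →
      |l2norm τ (relLog ρ h) - l2norm τ (relLog ρ h')| ≤ C * l2norm τ (h - h') := by
  set E := Real.exp R
  set P := Real.exp ‖ρ‖
  have hE : 0 ≤ E := Real.exp_nonneg _
  have hP : 0 ≤ P := Real.exp_nonneg _
  refine ⟨E * P * E * (E * E * (P * E) + E * P * (E * E)), ?_⟩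
  intro h h' hh hh' hR hR'
  have hnorm : ∀ c : A, IsSelfAdjoint c → ∀ r, ‖c‖ ≤ r → ‖exp c‖ ≤ Real.exp r := fun c hc r hr =>
    norm_exp_le_of_le hc (hc.le_algebraMap_norm_self.trans (algebraMap_mono A hr))
  have hexpneg : ∀ c : A, IsSelfAdjoint c → ‖c‖ ≤ R → ‖exp (-relLog ρ c)‖ ≤ E * P * E := by
    intro c hc hcR
    rw [exp_neg_of_exp_eq (exp_relLog hρ hc), neg_neg]
    refine (norm_mul_le _ _).trans (mul_le_mul ((norm_mul_le _ _).trans (mul_le_mul ?_ ?_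
      (norm_nonneg _) hE)) (hnorm c hc R hcR) (norm_nonneg _) (mul_nonneg hE hP))
    · exact hnorm c hc R hcR
    · exact hnorm (-ρ) hρ.neg _ (norm_neg ρ).le
  have h1 := hτ.l2norm_sub_sq_le_of_norm_le (isSelfAdjoint_relLog ρ h') (isSelfAdjoint_relLog ρ h)
    (hexpneg h' hh' hR') (hexpneg h hh hR)
  set d := l2norm τ (h - h')
  have hd : 0 ≤ d := l2norm_nonneg _ _
  have hlip : l2norm τ (exp (-h) - exp (-h')) ≤ E * E * d := by
    have := hτ.l2norm_exp_sub_exp_le hh.neg hh'.neg (R := R) (by rwa [norm_neg]) (by rwa [norm_neg])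
    rwa [neg_sub_neg, hτ.l2norm_sub_comm h' h] at this
  have hEh : ‖exp (-h)‖ ≤ E := hnorm _ hh.neg R (by rwa [norm_neg])
  have hEh' : ‖exp (-h')‖ ≤ E := hnorm _ hh'.neg R (by rwa [norm_neg])
  have hPρ : ‖exp ρ‖ ≤ P := hnorm ρ hρ _ le_rfl
  have h2 : l2norm τ (exp (relLog ρ h) - exp (relLog ρ h')) ≤
      E * E * d * (P * E) + E * P * (E * E * d) := by
    rw [exp_relLog hρ hh, exp_relLog hρ hh']
    have e : exp (-h) * exp ρ * exp (-h) - exp (-h') * exp ρ * exp (-h') =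
        (exp (-h) - exp (-h')) * (exp ρ * exp (-h)) +
          exp (-h') * exp ρ * (exp (-h) - exp (-h')) := by noncomm_ring
    rw [e]
    refine (hτ.l2norm_add_le _ _).trans (add_le_add ?_ ?_)
    · refine (hτ.l2norm_mul_le' _ _).trans (mul_le_mul hlip ?_ (norm_nonneg _) (by positivity))
      exact (norm_mul_le _ _).trans (mul_le_mul hPρ hEh (norm_nonneg _) hP)
    · refine (hτ.l2norm_mul_le _ _).trans (mul_le_mul ?_ hlip (l2norm_nonneg _ _) (by positivity))
      exact (norm_mul_le _ _).trans (mul_le_mul hEh' hPρ (norm_nonneg _) hE)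
  refine (hτ.abs_l2norm_sub_le _ _).trans (h1.trans ?_)
  calc _ ≤ E * P * E * (E * E * d * (P * E) + E * P * (E * E * d)) :=
        mul_le_mul_of_nonneg_left h2 (by positivity)
    _ = _ := by ring

end IsFaithfulNormalTrace

end DistanceFunction

/-- Closed complements in a Banach space are topological complements, so the projection onto `H`
along `S` is bounded; `B` is its norm. -/
theorem exists_bounded_decomposition {E : Type*} [NormedAddCommGroup E] [NormedSpace ℝ E]
    [CompleteSpace E] {H S : Submodule ℝ E} (hH : IsClosed (H : Set E))
    (hS : IsClosed (S : Set E)) (h : IsCompl H S) :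
    ∃ B : ℝ, 0 ≤ B ∧ ∀ x : E, ∃ a ∈ H, ∃ b ∈ S, x = a + b ∧ ‖a‖ ≤ B * ‖x‖ := by
  have h' := Submodule.isTopCompl_iff_isCompl_isClosed.2 ⟨h, hH, hS⟩
  refine ⟨‖Submodule.projectionOntoL H S h'‖, ContinuousLinearMap.opNorm_nonneg _, fun x =>
    ⟨Submodule.projectionOntoL H S h' x, Subtype.prop _, x - Submodule.projectionOntoL H S h' x,
      ?_, by abel, (Submodule.projectionOntoL H S h').le_opNorm x⟩⟩
  rw [← Submodule.projectionOntoL_apply_eq_zero_iff h', map_sub, sub_eq_zero,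
    Submodule.projectionOntoL_apply_left]

/-! ### Geodesically convex exponential sets -/

section ExponentialSets

variable {A : Type*} [CStarAlgebra A] [PartialOrder A] [StarOrderedRing A] {τ : A →ₗ[ℂ] ℂ}
  {H S : Submodule ℝ (selfAdjoint A)}

/-- If `x = a + b` is orthogonal to `S`, then `τ(b²) = 0` and faithfulness gives `b = 0`. Membership
in `H` thus becomes a family of L²-continuous linear equations, stable under L²-limits and under
analytic continuation. -/
theorem IsOrthogonalSupplement.mem_iff (hτ : IsFaithfulNormalTrace τ)
    (hS : IsOrthogonalSupplement τ H S) (x : selfAdjoint A) :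
    x ∈ H ↔ ∀ y ∈ S, τ ((x : A) * (y : A)) = 0 := by
  refine ⟨fun hx y hy => hS.orthogonal x hx y hy, fun h => ?_⟩
  obtain ⟨a, ha, b, hb, rfl⟩ := Submodule.mem_sup.1
    (hS.isCompl.sup_eq_top.symm ▸ Submodule.mem_top : x ∈ H ⊔ S)
  have h1 := h b hb
  rw [AddSubgroup.coe_add, add_mul, map_add, hS.orthogonal a ha b hb, zero_add] at h1
  have h2 : (b : A) = 0 := hτ.faithful _ (by rw [b.2.star_eq]; exact h1)
  have h3 : b = 0 := Subtype.ext h2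
  rwa [h3, add_zero]

omit [PartialOrder A] [StarOrderedRing A] in
theorem IsOrthogonalSupplement.exists_bound (hS : IsOrthogonalSupplement τ H S)
    (hH : IsClosed (H : Set (selfAdjoint A))) :
    ∃ B : ℝ, 0 ≤ B ∧ ∀ x : selfAdjoint A, ∃ a ∈ H, ∃ b ∈ S, x = a + b ∧ ‖a‖ ≤ B * ‖x‖ := by
  have : CompleteSpace (selfAdjoint A) := by
    have : IsClosed (selfAdjoint A : Set A) := isClosed_eq continuous_star continuous_id
    exact this.completeSpace_coe
  exact exists_bounded_decomposition hH hS.closed hS.isCompl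

omit [PartialOrder A] [StarOrderedRing A] in
theorem mem_of_exp_mem_expSet {x : selfAdjoint A} (h : exp (x : A) ∈ expSet H) : x ∈ H := by
  obtain ⟨y, hy, hxy⟩ := h
  have : y = x := Subtype.ext (exp_injective y.2 x.2 hxy)
  exact this ▸ hy

/-- A geodesically convex exponential set is stable under `(p, q) ↦ p^{1/2} q p^{1/2}`. -/
theorem exp_sandwich_mem_expSet (hτ : IsFaithfulNormalTrace τ)
    (hM : IsGeodConvex (expSet H)) (hS : IsOrthogonalSupplement τ H S) {h k : selfAdjoint A}
    (hh : h ∈ H) (hk : k ∈ H) : exp (h : A) * exp (k : A) * exp (h : A) ∈ expSet H := by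
  have hhs : IsSelfAdjoint (h : A) := h.2
  have hks : IsSelfAdjoint (k : A) := k.2
  set c : A := (1 / 2 : ℝ) • (k : A) with hc_def
  have hc : IsSelfAdjoint c := hks.real_smul _
  have hcc : exp c * exp c = exp (k : A) := exp_half_mul_exp_half _
  have hcc' : exp (-c) * exp (-c) = exp (-(k : A)) := by
    rw [hc_def, ← smul_neg, exp_half_mul_exp_half]
  set z : A := CFC.log (exp c * exp (h : A) * exp c) with hz_def
  have hz : IsSelfAdjoint z := IsSelfAdjoint.log
  have ez : exp z = exp c * exp (h : A) * exp c :=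
    CFC.exp_log _ (isStrictlyPositive_exp_conj hc (isStrictlyPositive_exp hhs))
  have ez' : exp (h : A) = exp (-c) * exp z * exp (-c) :=
    exp_sandwich_symm (by rw [neg_neg]; exact ez)
  -- The geodesic from `e^{-k}` to `e^h`. Its point at `t = 2`, the reflection of `e^{-k}` in `e^h`,
  -- is `e^h e^k e^h`. Convexity covers only `[0, 1]`; analyticity of `t ↦ τ(log γ(t) y)` for `y ∈
  -- S` extends its vanishing to `t = 2`.
  let γ : ℝ → A := fun t => exp (-c) * exp (t • z) * exp (-c)
  have hγ : IsGeodesic γ := isGeodesic_exp hc.neg hz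
  have hγ0 : γ 0 ∈ expSet H := by
    refine ⟨-k, H.neg_mem hk, ?_⟩
    simp only [γ, zero_smul, exp_zero, mul_one, hcc']
    rfl
  have hγ1 : γ 1 ∈ expSet H := ⟨h, hh, by simp only [γ, one_smul, ← ez']⟩
  have hγt := hM.2 γ hγ hγ0 hγ1
  let l : ℝ → selfAdjoint A := fun t => ⟨CFC.log (γ t), IsSelfAdjoint.log⟩
  have hl : ∀ t, exp (l t : A) = γ t := fun t =>
    CFC.exp_log _ (mem_posInv_iff.1 (hγ.mem t))
  have hlH : ∀ t ∈ Set.Icc (0 : ℝ) 1, l t ∈ H := fun t ht =>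
    mem_of_exp_mem_expSet (by rw [hl]; exact hγt t ht)
  have hl2 : l 2 ∈ H := by
    rw [hS.mem_iff hτ]
    intro y hy
    let φ : A →L[ℂ] ℂ := (⟨τ, hτ.continuous⟩ : A →L[ℂ] ℂ).comp
      ((ContinuousLinearMap.mul ℂ A).flip (y : A))
    exact apply_log_geodesic_eq_zero φ hc.neg hz
      (fun t ht => hS.orthogonal (l t) (hlH t ht) y hy) 2
  refine ⟨l 2, hl2, ?_⟩
  change exp (l 2 : A) = _
  rw [hl]
  calc γ 2 = exp (-c) * exp z * 1 * exp z * exp (-c) := by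
        simp only [γ, ← exp_mul_exp_self, mul_one, mul_assoc]
    _ = (exp (-c) * exp z * exp (-c)) * (exp c * exp c) * (exp (-c) * exp z * exp (-c)) := by
        rw [show (1 : A) = exp (-c) * exp c * (exp c * exp (-c)) by
          rw [exp_neg_mul_exp, exp_mul_exp_neg, one_mul]]
        simp only [mul_assoc]
    _ = _ := by rw [← ez', hcc]

/-- The midpoint of `e^{2h}` and `e^{2h'}` in a geodesically convex exponential set. -/
theorem exists_midpoint (hM : IsGeodConvex (expSet H)) {h h' : selfAdjoint A}
    (hh : h ∈ H) (hh' : h' ∈ H) :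
    ∃ l ∈ H, ∃ k : A, IsSelfAdjoint k ∧
      exp ((2 : ℝ) • k) = exp (-(h : A)) * exp ((2 : ℝ) • (h' : A)) * exp (-(h : A)) ∧
      exp ((2 : ℝ) • (l : A)) = exp (h : A) * exp k * exp (h : A) := by
  have hhs : IsSelfAdjoint (h : A) := h.2
  have hhs' : IsSelfAdjoint (h' : A) := h'.2
  set z : A := CFC.log (exp (-(h : A)) * exp ((2 : ℝ) • (h' : A)) * exp (-(h : A))) with hz_def
  have hz : IsSelfAdjoint z := IsSelfAdjoint.log
  have ez : exp z = exp (-(h : A)) * exp ((2 : ℝ) • (h' : A)) * exp (-(h : A)) :=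
    CFC.exp_log _ (isStrictlyPositive_exp_conj hhs.neg
      (isStrictlyPositive_exp (hhs'.real_smul 2)))
  let γ : ℝ → A := fun t => exp (h : A) * exp (t • z) * exp (h : A)
  have hγ0 : γ 0 ∈ expSet H := by
    refine ⟨(2 : ℝ) • h, H.smul_mem 2 hh, ?_⟩
    simp only [γ, zero_smul, exp_zero, mul_one, exp_mul_exp_self]
    rfl
  have hγ1 : γ 1 ∈ expSet H := by
    refine ⟨(2 : ℝ) • h', H.smul_mem 2 hh', ?_⟩
    simp only [γ, one_smul]
    exact exp_sandwich_symm ez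
  obtain ⟨l, hl, el⟩ := hM.2 γ (isGeodesic_exp hhs hz) hγ0 hγ1 (1 / 2) ⟨by norm_num, by norm_num⟩
  refine ⟨(1 / 2 : ℝ) • l, H.smul_mem _ hl, (1 / 2 : ℝ) • z, hz.real_smul _, ?_, ?_⟩
  · rw [smul_smul]; norm_num; exact ez
  · have e : (2 : ℝ) • (((1 / 2 : ℝ) • l : selfAdjoint A) : A) = (l : A) := by
      rw [selfAdjoint.val_smul, smul_smul]; norm_num
    rw [e]
    exact el

end ExponentialSets

/-! ### Existence and criticality of constrained minimizers -/

section Minimizer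

open Filter Topology

variable {K : Type*} [NormedAddCommGroup K] [InnerProductSpace ℂ K] [CompleteSpace K]
  {N : VonNeumannAlgebra K} {τ : N →ₗ[ℂ] ℂ} {H S : Submodule ℝ (selfAdjoint N)}

/-- The distance to `e^ρ` attains its minimum on bounded parts of `e^H`. -/
theorem exists_minimizer (hτ : IsFaithfulNormalTrace τ) (hM : IsGeodConvex (expSet H))
    (hS : IsOrthogonalSupplement τ H S) {ρ : N} (hρ : IsSelfAdjoint ρ) {R : ℝ} (hR : 0 ≤ R) :
    ∃ h ∈ H, ‖(h : N)‖ ≤ R ∧ ∀ h' ∈ H, ‖(h' : N)‖ ≤ R →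
      l2norm τ (relLog ρ (h : N)) ≤ l2norm τ (relLog ρ (h' : N)) := by
  let f : selfAdjoint N → ℝ := fun h => l2norm τ (relLog ρ (h : N)) ^ 2
  let B : Set (selfAdjoint N) := {h | h ∈ H ∧ ‖(h : N)‖ ≤ R}
  have hB0 : (0 : selfAdjoint N) ∈ B := ⟨H.zero_mem, by simpa using hR⟩
  have hbdd : BddBelow (f '' B) := ⟨0, by rintro _ ⟨h, _, rfl⟩; exact sq_nonneg _⟩
  set δ := sInf (f '' B) with hδ_def
  have hδ : ∀ h ∈ B, δ ≤ f h := fun h hh => csInf_le hbdd ⟨h, hh, rfl⟩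
  have hex : ∀ n : ℕ, ∃ h ∈ B, f h < δ + (1 / 8) ^ n := by
    intro n
    obtain ⟨_, ⟨h, hh, rfl⟩, hlt⟩ := exists_lt_of_csInf_lt (s := f '' B) ⟨_, 0, hB0, rfl⟩
      (show sInf (f '' B) < δ + (1 / 8) ^ n by
        have : (0 : ℝ) < (1 / 8) ^ n := by positivity
        linarith)
    exact ⟨h, hh, hlt⟩
  choose x hxB hxf using hex
  -- The midpoint is admissible, so its squared distance is at least `δ`, and the semi-parallelogram
  -- law leaves `2‖k‖² ≤ 8^{-n} + 8^{-(n+1)}`.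
  have hcauchy : ∀ n, l2norm τ ((x (n + 1) : N) - (x n : N)) ^ 2 ≤ (1 / 8) ^ n := by
    intro n
    obtain ⟨l, hl, k, hk, e1, e2⟩ := exists_midpoint hM (hxB n).1 (hxB (n + 1)).1
    have h1 := hτ.semi_parallelogram hρ (x n).2 (x (n + 1)).2 hk l.2 e1 e2
    have h2 := hτ.l2norm_sub_le_of_midpoint (x n).2 (x (n + 1)).2 hk e1
    have h3 := hδ l ⟨hl, norm_midpoint_le (x n).2 (x (n + 1)).2 hk l.2 e1 e2 (hxB n).2
      (hxB (n + 1)).2⟩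
    have h4 := hxf n
    have h5 := hxf (n + 1)
    have h6 : (1 / 8 : ℝ) ^ (n + 1) ≤ (1 / 8) ^ n :=
      pow_le_pow_of_le_one (by norm_num) (by norm_num) n.le_succ
    have h7 := pow_le_pow_left₀ (l2norm_nonneg _ _) h2 2
    simp only [f] at h3 h4 h5
    linarith
  obtain ⟨y, hy, hyR, hlim⟩ := hτ.exists_l2_limit (x := fun n => (x n : N)) (fun n => (x n).2)
    (fun n => (hxB n).2) hcauchy
  have hyH : (⟨y, hy⟩ : selfAdjoint N) ∈ H := by
    rw [hS.mem_iff hτ]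
    intro z hz
    have h1 : ∀ n, ‖τ (y * (z : N))‖ ≤ l2norm τ ((x n : N) - y) * l2norm τ (z : N) := by
      intro n
      have h2 := hS.orthogonal (x n) (hxB n).1 z hz
      have h3 := hτ.norm_apply_le (y - (x n : N)) (z : N)
      rw [(hy.sub (x n).2).star_eq, sub_mul, map_sub, h2, sub_zero, hτ.l2norm_sub_comm] at h3
      exact h3
    have h2 := hlim.mul_const (l2norm τ (z : N))
    rw [zero_mul] at h2
    exact norm_le_zero_iff.1 (ge_of_tendsto' h2 h1)
  obtain ⟨C, hC⟩ := hτ.exists_l2norm_relLog_sub_le hρ R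
  have hflim : Tendsto (fun n => l2norm τ (relLog ρ (x n : N))) atTop
      (𝓝 (l2norm τ (relLog ρ y))) := by
    rw [tendsto_iff_norm_sub_tendsto_zero]
    have h2 := hlim.const_mul C
    rw [mul_zero] at h2
    exact squeeze_zero (fun _ => norm_nonneg _)
      (fun n => hC _ _ (x n).2 hy (hxB n).2 hyR) h2
  have hfy : l2norm τ (relLog ρ y) ^ 2 ≤ δ := by
    have h2 : Tendsto (fun n : ℕ => δ + (1 / 8 : ℝ) ^ n) atTop (𝓝 (δ + 0)) :=
      (tendsto_pow_atTop_nhds_zero_of_lt_one (by norm_num) (by norm_num)).const_add δ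
    rw [add_zero] at h2
    exact le_of_tendsto_of_tendsto' (hflim.pow 2) h2 fun n => (hxf n).le
  refine ⟨⟨y, hy⟩, hyH, hyR, fun h' hh' hh'R => ?_⟩
  exact le_of_sq_le_sq (hfy.trans (hδ h' ⟨hh', hh'R⟩)) (l2norm_nonneg _ _)

/-- First-order condition at a minimizer. -/
theorem re_nonpos_of_minimizer (hτ : IsFaithfulNormalTrace τ) {ρ h x : N} (hρ : IsSelfAdjoint ρ)
    (hh : IsSelfAdjoint h) (hx : IsSelfAdjoint x) {ε₀ : ℝ} (hε₀ : 0 < ε₀)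
    (hmin : ∀ ε, 0 < ε → ε ≤ ε₀ → ∃ l : N, IsSelfAdjoint l ∧
      exp ((2 : ℝ) • l) = exp h * exp (ε • x) * exp h ∧
      l2norm τ (relLog ρ h) ≤ l2norm τ (relLog ρ l)) :
    (τ (relLog ρ h * x)).re ≤ 0 := by
  set s := relLog ρ h with hs_def
  have hs : IsSelfAdjoint s := isSelfAdjoint_relLog ρ h
  have es : exp s = exp (-h) * exp ρ * exp (-h) := exp_relLog hρ hh
  let c : ℝ → N := fun ε => exp (ε • ((-(1 / 2) : ℝ) • x)) * exp s * exp (ε • ((-(1 / 2) : ℝ) • x))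
  have hx2 : IsSelfAdjoint ((-(1 / 2) : ℝ) • x) := hx.real_smul _
  have hcpos : ∀ ε, IsStrictlyPositive (c ε) := fun ε =>
    isStrictlyPositive_exp_conj (hx2.real_smul ε) (isStrictlyPositive_exp hs)
  have hcc : Continuous c := by
    have h1 : Continuous fun ε : ℝ => exp (ε • ((-(1 / 2) : ℝ) • x)) :=
      continuous_iff_continuousAt.2 fun ε =>
        (hasDerivAt_exp_smul_const (𝕂 := ℝ) ((-(1 / 2) : ℝ) • x) ε).continuousAt
    exact (h1.mul continuous_const).mul h1
  let σ : ℝ → N := fun ε => CFC.log (c ε)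
  have hσ : ∀ ε, IsSelfAdjoint (σ ε) := fun ε => IsSelfAdjoint.log
  have eσ : ∀ ε, exp (σ ε) = c ε := fun ε => CFC.exp_log _ (hcpos ε)
  have hσc : Continuous σ := CFC.continuousOn_log.comp_continuous hcc fun ε =>
    ⟨(hcpos ε).nonneg.isSelfAdjoint, (hcpos ε).isUnit⟩
  have hσ0 : σ 0 = s := exp_injective (hσ 0) hs (by
    rw [eσ]; simp [c])
  -- `‖σ ε‖` is the distance at the competitor. The metric increasing property and minimality give
  -- `‖σ ε + εx‖ ≤ ‖s‖ ≤ ‖σ ε‖`; expanding the square gives the sign without differentiating the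
  -- distance.
  have key : ∀ ε, 0 < ε → ε ≤ ε₀ → (τ (σ ε * x)).re ≤ 0 := by
    intro ε hε hε'
    obtain ⟨l, hl, el, hle⟩ := hmin ε hε hε'
    have e0 : ε • ((-(1 / 2) : ℝ) • x) = -((1 / 2 : ℝ) • (ε • x)) := by
      rw [smul_comm, neg_smul]
    set w := (1 / 2 : ℝ) • (ε • x) with hw_def
    have hw : IsSelfAdjoint w := (hx.real_smul ε).real_smul _
    have eww : exp w * exp w = exp (ε • x) := exp_half_mul_exp_half _
    have eσ' : exp (σ ε) = exp (-w) * exp s * exp (-w) := by rw [eσ]; simp only [c, e0]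
    have h1 : l2norm τ (relLog ρ l) = l2norm τ (σ ε) := by
      refine hτ.l2norm_relLog_eq (a := exp h * exp w) (b := exp (-w) * exp (-h)) hρ hl (hσ ε)
        ?_ ?_ ?_ ?_
      · calc _ = exp h * (exp w * exp (-w)) * exp (-h) := by simp only [mul_assoc]
          _ = 1 := by rw [exp_mul_exp_neg, mul_one, exp_mul_exp_neg]
      · calc _ = exp (-w) * (exp (-h) * exp h) * exp w := by simp only [mul_assoc]
          _ = 1 := by rw [exp_neg_mul_exp, mul_one, exp_neg_mul_exp]
      · rw [el, star_mul, hw.exp.star_eq, hh.exp.star_eq, ← eww]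
        simp only [mul_assoc]
      · rw [eσ', es, star_mul, hw.neg.exp.star_eq, hh.neg.exp.star_eq]
        simp only [mul_assoc]
    have h2 : l2norm τ (σ ε - -(ε • x)) ≤ l2norm τ s :=
      hτ.l2norm_sub_le_of_exp_eq (hx.real_smul ε).neg (hσ ε) hs (by rw [smul_neg]; exact eσ')
    rw [sub_neg_eq_add] at h2
    have h3 := pow_le_pow_left₀ (l2norm_nonneg _ _) (h2.trans (hle.trans h1.le)) 2
    have h4 : l2norm τ (σ ε + ε • x) ^ 2 =
        l2norm τ (σ ε) ^ 2 + 2 * ε * (τ (σ ε * x)).re + ε ^ 2 * l2norm τ x ^ 2 := by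
      rw [hτ.l2norm_sq_of_isSelfAdjoint ((hσ ε).add (hx.real_smul ε)),
        hτ.l2norm_sq_of_isSelfAdjoint (hσ ε), hτ.l2norm_sq_of_isSelfAdjoint hx]
      rw [← hτ.reCLM_apply, ← hτ.reCLM_apply, ← hτ.reCLM_apply, ← hτ.reCLM_apply]
      simp only [add_mul, mul_add, smul_mul_assoc, mul_smul_comm, map_add, map_smul, smul_eq_mul]
      have : hτ.reCLM (x * σ ε) = hτ.reCLM (σ ε * x) := by
        rw [hτ.reCLM_apply, hτ.reCLM_apply, hτ.tracial]
      rw [this]; ring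
    rw [h4] at h3
    have h5 : ε * (τ (σ ε * x)).re ≤ 0 := by nlinarith [sq_nonneg (ε * l2norm τ x)]
    exact nonpos_of_mul_nonpos_right h5 hε
  have hlim : Tendsto (fun ε => (τ (σ ε * x)).re) (𝓝[>] 0) (𝓝 (τ (s * x)).re) := by
    have h1 : Continuous fun ε => (τ (σ ε * x)).re :=
      Complex.continuous_re.comp (hτ.continuous.comp (hσc.mul continuous_const))
    have h2 := h1.tendsto 0
    simp only [hσ0] at h2
    exact h2.mono_left nhdsWithin_le_nhds
  refine le_of_tendsto hlim ?_
  filter_upwards [Ioc_mem_nhdsGT hε₀] with ε hε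
  exact key ε hε.1 hε.2

/-- A bounded minimizer of the distance to `e^ρ` is a critical point. -/
theorem eq_zero_of_minimizer (hτ : IsFaithfulNormalTrace τ) (hM : IsGeodConvex (expSet H))
    (hS : IsOrthogonalSupplement τ H S) {ρ : N} (hρ : IsSelfAdjoint ρ) {R : ℝ}
    {h a b : selfAdjoint N} (hhH : h ∈ H) (hhR : ‖(h : N)‖ ≤ R)
    (hmin : ∀ h' ∈ H, ‖(h' : N)‖ ≤ R → l2norm τ (relLog ρ (h : N)) ≤ l2norm τ (relLog ρ (h' : N)))
    (hb : b ∈ S) (haR : ‖(a : N)‖ ≤ 2 * R - 1) {x : selfAdjoint N} (hxH : x ∈ H)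
    (hxN : (x : N) = (a : N) - (2 : ℝ) • (h : N)) (hsx : relLog ρ (h : N) = (x : N) + (b : N)) :
    (x : N) = 0 := by
  have hh : IsSelfAdjoint (h : N) := h.2
  obtain ⟨ε₀, hε₀, hε₀'⟩ : ∃ ε₀ : ℝ, 0 < ε₀ ∧ ε₀ * (1 + ‖(x : N)‖ + ‖(x : N)‖ ^ 2) = 1 :=
    ⟨(1 + ‖(x : N)‖ + ‖(x : N)‖ ^ 2)⁻¹, by positivity, inv_mul_cancel₀ (by positivity)⟩
  have hle := re_nonpos_of_minimizer (τ := τ) hτ hρ hh x.2 hε₀ (by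
    intro ε hε hε'
    have hε3 : ε * (1 + ‖(x : N)‖ + ‖(x : N)‖ ^ 2) ≤ 1 :=
      (mul_le_mul_of_nonneg_right hε' (by positivity)).trans hε₀'.le
    obtain ⟨l, hl, el⟩ := exp_sandwich_mem_expSet hτ hM hS hhH (H.smul_mem ε hxH)
    obtain ⟨l', hl', hl2⟩ : ∃ l' ∈ H, (2 : ℝ) • (l' : N) = (l : N) :=
      ⟨(1 / 2 : ℝ) • l, H.smul_mem _ hl, by
        rw [selfAdjoint.val_smul, smul_smul]; norm_num⟩
    have el' : exp ((2 : ℝ) • (l' : N)) = exp (h : N) * exp (ε • (x : N)) * exp (h : N) := by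
      rw [hl2, ← selfAdjoint.val_smul]; exact el
    exact ⟨(l' : N), l'.2, el', hmin l' hl'
      (norm_le_of_exp_eq_sandwich hh a.2 l'.2 hxN hhR haR hε hε3 el')⟩)
  -- `τ(bx) = 0` by orthogonality, so the first-order condition is `τ(x²) ≤ 0`.
  have hτx : l2norm τ (x : N) ^ 2 ≤ 0 := by
    rw [hsx, add_mul, map_add, hτ.tracial (b : N), hS.orthogonal x hxH b hb, add_zero,
      ← hτ.l2norm_sq_of_isSelfAdjoint x.2] at hle
    exact hle
  exact hτ.eq_zero_of_l2norm (by nlinarith [l2norm_nonneg τ (x : N)])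

/-- Every positive invertible element factors as `e^h e^s e^h` with `h ∈ H` and `s ∈ S`. -/
theorem exists_factorization (hτ : IsFaithfulNormalTrace τ)
    (hH : IsClosed (H : Set (selfAdjoint N))) (hM : IsGeodConvex (expSet H))
    (hS : IsOrthogonalSupplement τ H S) {r : N} (hr : r ∈ posInv N) :
    ∃ h ∈ H, ∃ s ∈ S, r = exp (h : N) * exp (s : N) * exp (h : N) := by
  obtain ⟨ρ, hρ, eρ⟩ : ∃ ρ : N, IsSelfAdjoint ρ ∧ exp ρ = r :=
    ⟨CFC.log r, IsSelfAdjoint.log, CFC.exp_log _ (mem_posInv_iff.1 hr)⟩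
  obtain ⟨B, hB, hproj⟩ := hS.exists_bound hH
  -- Whatever the minimizer, the `H`-component of `relLog ρ h + 2h` has norm at most `B‖ρ‖`, which
  -- is made equal to the `2R - 1` needed for an inward direction.
  obtain ⟨R, hR⟩ : ∃ R : ℝ, 2 * R - 1 = B * ‖ρ‖ := ⟨(B * ‖ρ‖ + 1) / 2, by ring⟩
  have hR0 : 0 ≤ R := by nlinarith [mul_nonneg hB (norm_nonneg ρ)]
  obtain ⟨h, hhH, hhR, hmin⟩ := exists_minimizer hτ hM hS hρ hR0
  have hh : IsSelfAdjoint (h : N) := h.2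
  obtain ⟨s, hs⟩ : ∃ s : selfAdjoint N, (s : N) = relLog ρ (h : N) :=
    ⟨⟨relLog ρ (h : N), isSelfAdjoint_relLog _ _⟩, rfl⟩
  obtain ⟨a, ha, b, hb, hab, haB⟩ := hproj (s + (2 : ℝ) • h)
  have hnorm : ‖s + (2 : ℝ) • h‖ ≤ ‖ρ‖ := by
    rw [← AddSubgroup.norm_coe, AddSubgroup.coe_add, selfAdjoint.val_smul, hs]
    exact norm_relLog_add_le hρ hh
  have haR : ‖(a : N)‖ ≤ 2 * R - 1 := by
    rw [hR, AddSubgroup.norm_coe]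
    exact haB.trans (mul_le_mul_of_nonneg_left hnorm hB)
  obtain ⟨x, hx⟩ : ∃ x : selfAdjoint N, x = a - (2 : ℝ) • h := ⟨_, rfl⟩
  have hxH : x ∈ H := hx ▸ H.sub_mem ha (H.smul_mem 2 hhH)
  have hsx : s = x + b := by
    rw [hx, sub_add_eq_add_sub, ← hab, add_sub_cancel_right]
  have hx0 : (x : N) = 0 := by
    refine eq_zero_of_minimizer hτ hM hS hρ hhH hhR hmin hb haR hxH ?_ ?_
    · rw [hx, AddSubgroup.coe_sub, selfAdjoint.val_smul]
    · rw [← hs, hsx, AddSubgroup.coe_add]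
  have hsb : (s : N) = b := by rw [hsx, AddSubgroup.coe_add, hx0, zero_add]
  refine ⟨h, hhH, b, hb, ?_⟩
  rw [← eρ, ← hsb, hs]
  exact exp_sandwich_symm (exp_relLog hρ hh)

end Minimizer

/-! ### Normal vectors and the exponential map -/

section NormalBundle

variable {A : Type*} [CStarAlgebra A] [PartialOrder A] [StarOrderedRing A] {τ : A →ₗ[ℂ] ℂ}
  {H S : Submodule ℝ (selfAdjoint A)}

/-- Congruence by `e^h` carries the metric at `1` to the metric at `e^{2h}`, so the pairing with the
tangent vector `e^h k e^h` is `τ(sk)`. -/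
theorem isNormalAt_exp (hτ : IsFaithfulNormalTrace τ) (hS : IsOrthogonalSupplement τ H S)
    (h : selfAdjoint A) {s : selfAdjoint A} (hs : s ∈ S) :
    IsNormalAt τ H (exp ((2 : ℝ) • (h : A))) (exp (h : A) * (s : A) * exp (h : A)) := by
  rintro _ ⟨k, hk, rfl⟩
  simp only [metricAt, rpow_half_exp h.2, inverse_exp]
  have e : exp (-((2 : ℝ) • (h : A))) = exp (-(h : A)) * exp (-(h : A)) := by
    rw [exp_mul_exp_self, smul_neg]
  have e2 : exp (h : A) * (s : A) * exp (h : A) * (exp (-(h : A)) * exp (-(h : A))) *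
      (exp (h : A) * (k : A) * exp (h : A)) * (exp (-(h : A)) * exp (-(h : A))) =
      exp (h : A) * ((s : A) * (k : A) * exp (-(h : A))) := by
    calc _ = exp (h : A) * (s : A) * (exp (h : A) * exp (-(h : A))) *
          (exp (-(h : A)) * exp (h : A)) * (k : A) * (exp (h : A) * exp (-(h : A))) *
          exp (-(h : A)) := by simp only [mul_assoc]
      _ = _ := by
        rw [exp_mul_exp_neg, exp_neg_mul_exp]; simp only [mul_one, mul_assoc]
  rw [e, e2, hτ.tracial, mul_assoc, exp_neg_mul_exp, mul_one, hτ.tracial]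
  exact hS.orthogonal k hk s hs

theorem expMap_exp_conj {h s : A} (hh : IsSelfAdjoint h) :
    expMap (exp ((2 : ℝ) • h)) (exp h * s * exp h) = exp h * exp s * exp h := by
  rw [expMap, rpow_half_exp hh, rpow_neg_half_exp hh]
  congr 3
  calc _ = exp (-h) * exp h * s * (exp h * exp (-h)) := by simp only [mul_assoc]
    _ = s := by rw [exp_neg_mul_exp, exp_mul_exp_neg, one_mul, mul_one]

theorem expMap_mem_posInv {p v : A} (hp : p ∈ expSet H) (hv : IsSelfAdjoint v) :
    expMap p v ∈ posInv A := by
  obtain ⟨l, _, rfl⟩ := hp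
  have hl : IsSelfAdjoint ((1 / 2 : ℝ) • (l : A)) := IsSelfAdjoint.real_smul l.2 _
  have e : (l : A) = (2 : ℝ) • ((1 / 2 : ℝ) • (l : A)) := by rw [smul_smul]; norm_num
  simp only [expMap]
  rw [e, rpow_half_exp hl, rpow_neg_half_exp hl, mem_posInv_iff]
  refine isStrictlyPositive_exp_conj hl (isStrictlyPositive_exp ?_)
  have := hv.conjugate (exp (-((1 / 2 : ℝ) • (l : A))))
  rwa [hl.neg.exp.star_eq] at this

end NormalBundle

end PosGeom

theorem mainTheorem4 {K : Type*} [NormedAddCommGroup K] [InnerProductSpace ℂ K] [CompleteSpace K]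
    (N : VonNeumannAlgebra K) (τ : N →ₗ[ℂ] ℂ) (hτ : PosGeom.IsFaithfulNormalTrace τ)
    (H : Submodule ℝ (selfAdjoint N)) (hH : IsClosed (H : Set (selfAdjoint N)))
    (hM : PosGeom.IsGeodConvex (PosGeom.expSet H))
    (S : Submodule ℝ (selfAdjoint N)) (hS : PosGeom.IsOrthogonalSupplement τ H S) :
    (∀ r ∈ PosGeom.posInv N, ∃ γ : ℝ → N,
      PosGeom.IsGeodesic γ ∧ (∃ t, γ t = r) ∧ PosGeom.IsOrthogonalTo τ H γ) ∧
    (fun z : N × N => PosGeom.expMap z.1 z.2) '' PosGeom.normalBundle τ H =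
      PosGeom.posInv N := by
  refine ⟨fun r hr => ?_, Set.Subset.antisymm ?_ fun r hr => ?_⟩
  · obtain ⟨h, hh, s, hs, rfl⟩ := PosGeom.exists_factorization hτ hH hM hS hr
    -- The geodesic reaches `r` at `t = 1`; its foot point on `M` is `e^{2h}` at `t = 0`, with
    -- velocity `e^h s e^h`.
    refine ⟨fun t => NormedSpace.exp (h : N) * NormedSpace.exp (t • (s : N)) *
      NormedSpace.exp (h : N), PosGeom.isGeodesic_exp h.2 s.2, ⟨1, by simp only [one_smul]⟩,
      0, ?_⟩
    have hd := ((hasDerivAt_exp_smul_const (𝕂 := ℝ) (s : N) 0).const_mul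
      (NormedSpace.exp (h : N))).mul_const (NormedSpace.exp (h : N))
    rw [hd.deriv]
    simp only [zero_smul, NormedSpace.exp_zero, mul_one, one_mul, PosGeom.exp_mul_exp_self]
    exact ⟨⟨(2 : ℝ) • h, H.smul_mem 2 hh, rfl⟩, PosGeom.isNormalAt_exp hτ hS h hs⟩
  · rintro _ ⟨⟨p, v⟩, ⟨hp, hv, _⟩, rfl⟩
    exact PosGeom.expMap_mem_posInv hp hv
  · obtain ⟨h, hh, s, hs, rfl⟩ := PosGeom.exists_factorization hτ hH hM hS hr
    refine ⟨(NormedSpace.exp ((2 : ℝ) • (h : N)),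
      NormedSpace.exp (h : N) * (s : N) * NormedSpace.exp (h : N)),
      ⟨⟨(2 : ℝ) • h, H.smul_mem 2 hh, rfl⟩, ?_, PosGeom.isNormalAt_exp hτ hS h hs⟩,
      PosGeom.expMap_exp_conj h.2⟩
    have := IsSelfAdjoint.conjugate s.2 (NormedSpace.exp (h : N))
    rwa [(IsSelfAdjoint.exp h.2).star_eq] at this
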